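/- **Conventions.** A geodesic metric space is $\delta$-hyperbolic if $(x|z)_p\ge\min\{(x|y)_p,(y|z)_p\}-\delta$ for all points $p,x,y,z$, where $(x|y)_p=\tfrac12(d(x,p)+d(y,p)-d(x,y))$. The Gromov boundary $\partial Z$ of a hyperbolic space $Z$ is the set of classes of sequences $(u_n)$ with $(u_m|u_n)_p\to\infty$, where $(u_n)\sim(v_n)$ if $(u_m|v_n)_p\to\infty$ as $m,n\to\infty$ (if $Z$ is proper, these are the asymptote classes of geodesic rays). The Gromov compactification is $\widehat Z=Z\cup\partial Z$, in which $Z$ is open with its metric topology and the sets $\{z\in\widehat Z:(\xi|z)_p>r\}$, $r\in\mathbb R$, form a neighbourhood basis at $\xi\in\partial Z$; here $(a|b)_p$ denotes the supremum of $\liminf_{m,n}(u_m|v_n)_p$ over sequences $(u_m)$, $(v_n)$ representing $a$, $b$ (constant sequences for points of $Z$). A $(K,\varepsilon)$-quasi-isometry is a map $f$ with $\tfrac1K d(a,a')-\varepsilon\le d(f(a),f(a'))\le K d(a,a')+\varepsilon$ whose image is $\varepsilon$-dense. **Trees of spaces.** Let $T=\mathbb R$ or $T=[0,\infty)$, regarded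 as a simplicial tree with vertices the integers in $T$. A tree ($T$) of spaces is a metric space $X$ with a continuous surjection $P:X\to T$ such that: 1. for each vertex $j$, the vertex space $Y_j=P^{-1}(j)$ carries a metric, namely the path metric induced from $X$; 2. for each edge $[j,j+1]$ of $T$ there are a metric space $E_j$ (the edge space) and a continuous map $f_j:E_j\times[0,1]\to X$ with $P(f_j(e,t))=j+t$, such that $f_j$ restricted to $E_j\times(0,1)$, with the product metric $\sqrt{d(e,e')^2+(s-t)^2}$, is an isometry onto $P^{-1}((j,j+1))$ with its induced path metric. The edge-to-vertex inclusions are the maps $f_j(\cdot,0):E_j\to Y_j$ and $f_j(\cdot,1):E_j\to Y_{j+1}$. **Theorem 3.5.** Let $X$ be a tree ($T$) of spaces as above, with $T=\mathbb R$ or $T=[0,\infty)$. Assume that $X$ is a hyperbolic geodesic metric space, that all vertex spaces $Y_j$ and edge spaces $E_j$ are geodesic and $\delta$-hyperbolic for one $\delta$, and that all edge-to-vertex inclusions are $(K,\varepsilon)$-quasi-isometries for one pair of constants $K\ge1$, $\varepsilon\ge0$. Then there is a Cannon–Thurston map for the inclusion $i:Y_0\to X$, that is, a continuous map $\hat i:\widehat{Y_0}\to\widehat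 X$ whose restriction to $Y_0$ is $i$. -/

import Mathlib

open Set Filter Topology
open scoped ENNReal

section Hyperbolic

/-- The Gromov product `(x|y)_p`. -/
noncomputable def gromovProduct {X : Type*} [MetricSpace X] (p x y : X) : ℝ :=
  (dist x p + dist y p - dist x y) / 2

/-- Any two points are joined by a geodesic segment, parametrized by arc length. -/
def IsGeodesicSpace (X : Type*) [MetricSpace X] : Prop :=
  ∀ x y : X, ∃ c : ℝ → X, c 0 = x ∧ c (dist x y) = y ∧
    ∀ s ∈ Icc 0 (dist x y), ∀ t ∈ Icc 0 (dist x y), dist (c s) (c t) = |s - t|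

/-- A `δ`-hyperbolic metric space: a geodesic metric space whose Gromov products satisfy
`(x|z)_p ≥ min ((x|y)_p, (y|z)_p) - δ`. -/
def IsHyperbolicSpace (δ : ℝ) (X : Type*) [MetricSpace X] : Prop :=
  IsGeodesicSpace X ∧
    ∀ p x y z : X, min (gromovProduct p x y) (gromovProduct p y z) - δ ≤ gromovProduct p x z

/-- A `(K, ε)`-quasi-isometric embedding. -/
def IsQIEmbedding {A B : Type*} [MetricSpace A] [MetricSpace B] (K ε : ℝ) (f : A → B) : Prop :=
  ∀ a a' : A, dist a a' / K - ε ≤ dist (f a) (f a') ∧ dist (f a) (f a') ≤ K * dist a a' + ε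

/-- A `(K, ε)`-quasi-isometry: a `(K, ε)`-quasi-isometric embedding with `ε`-dense image. -/
def IsQuasiIsometry {A B : Type*} [MetricSpace A] [MetricSpace B] (K ε : ℝ) (f : A → B) : Prop :=
  IsQIEmbedding K ε f ∧ ∀ b : B, ∃ a : A, dist (f a) b ≤ ε

end Hyperbolic

section Compactification

/-- The Gromov products `(u m|v n)_p` tend to infinity with `m` and `n`, for every base point `p`
(equivalently, for one base point). -/
def SameEnd {X : Type*} [MetricSpace X] (u v : ℕ → X) : Prop :=
  ∀ p : X, Tendsto (fun q : ℕ × ℕ => gromovProduct p (u q.1) (v q.2)) atTop atTop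

/-- The sequences converging at infinity: `(u m|u n)_p → ∞`. -/
def GromovSequence (X : Type*) [MetricSpace X] : Type _ :=
  {u : ℕ → X // SameEnd u u}

/-- The Gromov boundary: sequences converging at infinity, two of them being identified when
`(u m|v n)_p → ∞`. In a hyperbolic space this relation is an equivalence relation. -/
def GromovBoundary (X : Type*) [MetricSpace X] : Type _ :=
  Quot (fun u v : GromovSequence X => SameEnd u.1 v.1)

/-- The Gromov compactification `X ∪ ∂X`, as a set. -/
inductive GromovCompactification (X : Type*) [MetricSpace X] : Type _
  | pt (x : X) : GromovCompactification X
  | ideal (ξ : GromovBoundary X) : GromovCompactification X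

/-- The sequences representing a point of `X ∪ ∂X`: the constant sequence for a point of `X`,
the members of the class for a boundary point. -/
def Represents {X : Type*} [MetricSpace X] (u : ℕ → X) : GromovCompactification X → Prop
  | .pt x => ∀ n, u n = x
  | .ideal ξ => ∃ h : SameEnd u u, Quot.mk _ (⟨u, h⟩ : GromovSequence X) = ξ

/-- The extended Gromov product `(a|b)_p` of two points of `X ∪ ∂X`, that is the supremum of
`liminf (u m|v n)_p` over the representing sequences, exceeds `r`. -/
def ProductExceeds {X : Type*} [MetricSpace X] (p : X) (r : ℝ)
    (a b : GromovCompactification X) : Prop :=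
  ∃ u v : ℕ → X, Represents u a ∧ Represents v b ∧
    ∀ᶠ q : ℕ × ℕ in atTop, r < gromovProduct p (u q.1) (v q.2)

/-- The topology of `X ∪ ∂X`: that of `X` at the points of `X`, while the sets
`{z | (ξ|z)_p > r}`, `r ∈ ℝ`, form a neighbourhood basis at a boundary point `ξ`. -/
instance {X : Type*} [MetricSpace X] : TopologicalSpace (GromovCompactification X) where
  IsOpen U := IsOpen {x : X | GromovCompactification.pt x ∈ U} ∧
    ∀ ξ : GromovBoundary X, GromovCompactification.ideal ξ ∈ U → ∀ p : X, ∃ r : ℝ,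
      ∀ z : GromovCompactification X,
        ProductExceeds p r (GromovCompactification.ideal ξ) z → z ∈ U
  isOpen_univ := ⟨by simp, fun _ _ _ => ⟨0, fun _ _ => mem_univ _⟩⟩
  isOpen_inter := by
    rintro U V ⟨hU, hU'⟩ ⟨hV, hV'⟩
    refine ⟨hU.inter hV, fun ξ hξ p => ?_⟩
    obtain ⟨r, hr⟩ := hU' ξ hξ.1 p
    obtain ⟨s, hs⟩ := hV' ξ hξ.2 p
    refine ⟨max r s, ?_⟩
    rintro z ⟨u, v, hu, hv, h⟩
    exact ⟨hr z ⟨u, v, hu, hv, h.mono fun _ hq => lt_of_le_of_lt (le_max_left r s) hq⟩,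
      hs z ⟨u, v, hu, hv, h.mono fun _ hq => lt_of_le_of_lt (le_max_right r s) hq⟩⟩
  isOpen_sUnion := by
    intro S hS
    refine ⟨?_, ?_⟩
    · have : {x : X | GromovCompactification.pt x ∈ ⋃₀ S} =
          ⋃ U ∈ S, {x : X | GromovCompactification.pt x ∈ U} := by
        ext x
        simp
      rw [this]
      exact isOpen_biUnion fun U hU => (hS U hU).1
    · rintro ξ ⟨U, hU, hξ⟩ p
      obtain ⟨r, hr⟩ := (hS U hU).2 ξ hξ p
      exact ⟨r, fun z hz => ⟨U, hU, hr z hz⟩⟩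

/-- `F` is a Cannon–Thurston map for `i`: a continuous extension of `i` to the Gromov
compactifications. -/
def IsCannonThurstonMap {A X : Type*} [MetricSpace A] [MetricSpace X] (i : A → X)
    (F : GromovCompactification A → GromovCompactification X) : Prop :=
  Continuous F ∧
    ∀ a : A, F (GromovCompactification.pt a) = GromovCompactification.pt (i a)

end Compactification

section Trees

/-- The path metric induced on a subset `S`: the infimum of the lengths of the paths in `S`. -/
noncomputable def inducedPathEDist {X : Type*} [MetricSpace X] (S : Set X) (x y : X) : ℝ≥0∞ :=
  ⨅ (γ : Path x y) (_ : ∀ t, γ t ∈ S), eVariationOn γ univ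

/-- A tree of spaces over a subtree `T` of the real line, whose vertices are the integers and whose
edges are the intervals `[j, j + 1]`: a space `X` with a continuous map onto `T`, where
* the vertex space `Y j` is the fibre over the vertex `j`, with its induced path metric;
* the part of `X` over the edge `[j, j + 1]` is a strip, the image of the product of the
  edge space `E j` with `[0, 1]`; over the open edge the strip is isometric to the
  metric product of `E j` with `(0, 1)`, for the induced path metric, and its two ends are attached
  to the vertex spaces at `j` and at `j + 1`.
When `j` (resp. the edge `[j, j + 1]`) is not in `T`, `Y j` (resp. `E j`) is empty. -/
structure TreeOfSpaces (T : Set ℝ) (X : Type*) [MetricSpace X] (Y E : ℤ → Type*)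
    [∀ j, MetricSpace (Y j)] [∀ j, MetricSpace (E j)] where
  /-- the projection to the tree -/
  proj : X → ℝ
  continuous_proj : Continuous proj
  range_proj : range proj = T
  /-- the inclusion of a vertex space -/
  incl : ∀ j, Y j → X
  range_incl : ∀ j : ℤ, range (incl j) = {x | proj x = j}
  edist_vertex : ∀ (j : ℤ) (a b : Y j),
    edist a b = inducedPathEDist {x | proj x = j} (incl j a) (incl j b)
  /-- the strip over an edge -/
  strip : ∀ j, E j × unitInterval → X
  continuous_strip : ∀ j, Continuous (strip j)
  proj_strip : ∀ (j : ℤ) (e : E j) (t : unitInterval), proj (strip j (e, t)) = j + t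
  strip_surj : ∀ (j : ℤ) (x : X), proj x ∈ Ioo (j : ℝ) (j + 1) → ∃ q, strip j q = x
  strip_isometry : ∀ (j : ℤ) (e e' : E j) (s t : unitInterval),
    (s : ℝ) ∈ Ioo (0 : ℝ) 1 → (t : ℝ) ∈ Ioo (0 : ℝ) 1 →
      inducedPathEDist {x | proj x ∈ Ioo (j : ℝ) (j + 1)} (strip j (e, s)) (strip j (e', t)) =
        ENNReal.ofReal (Real.sqrt (dist e e' ^ 2 + ((s : ℝ) - t) ^ 2))
  /-- the inclusion of the edge space of `[j, j + 1]` into the vertex space at `j` -/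
  lower : ∀ j, E j → Y j
  strip_zero : ∀ (j : ℤ) (e : E j), strip j (e, 0) = incl j (lower j e)
  /-- the inclusion of the edge space of `[j, j + 1]` into the vertex space at `j + 1` -/
  upper : ∀ j, E j → Y (j + 1)
  strip_one : ∀ (j : ℤ) (e : E j), strip j (e, 1) = incl (j + 1) (upper j e)

end Trees

/-!
A coarse Lipschitz retract of a hyperbolic space is quasiconvex, because a path that avoids a ball
of radius `D` and surrounds its center has length exponential in `D`
(`exists_dist_retraction_le`). This single fact replaces the stability of quasi-geodesics, and it is
used twice.

It shows that quasi-isometries of hyperbolic spaces, in the symmetric form of coarse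
correspondences, send points close to a geodesic `[a, b]` to points close to a geodesic between the
images (`exists_gromovProduct_le_of_correspondence`). They therefore preserve coarse centers of
triangles, that is projections to geodesics.

Let now `a` and `b` be points of `Y 0`. Flow them through the strips to all vertex spaces, and
consider the ladder formed by the points of each vertex space that lie close to a geodesic
between the images of `a` and `b`. By the preceding paragraph, the projections to these
geodesics fit together to a coarse Lipschitz retraction of `X` onto the ladder
(`CoarseStack.exists_ladder_retraction`), so a geodesic of `X` from `a` to `b` stays close to the
ladder. A point of the ladder over the vertex `j` is at distance at least `|j|` from a point `p` of
`Y 0`, since the projection to the tree is `1`-Lipschitz, and at distance at most `C * |j|` from a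
point of `Y 0` close to a geodesic of `Y 0` between `a` and `b` (`CoarseStack.exists_ladder_path`).
As `Y 0` is properly embedded in `X`, it follows that the ladder is far away from `p` in `X` if
`[a, b]` is far away from `p` in `Y 0`. In terms of Gromov products, `(a|b)_p` large in `Y 0` forces
`(a|b)_p` large in `X` (`CoarseStack.exists_le_gromovProduct_incl`), which is what the continuous
extension to the boundary requires (`exists_isCannonThurstonMap`).

The geometry of the strips enters through one estimate: collapsing the strips adjacent to a vertex
space does not increase distances, from the metric of `X` to the path metric of the vertex space,
for points close to each other and to the vertex space (`TreeOfSpaces.dist_le_of_collapse`).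
-/

universe u v

/-! ### Gromov products and coarse centers -/

section GromovProduct

variable {Z : Type*} [MetricSpace Z]

lemma gromovProduct_nonneg (p x y : Z) : 0 ≤ gromovProduct p x y := by
  have := dist_triangle_right x y p
  unfold gromovProduct
  linarith

lemma gromovProduct_self_left (p x : Z) : gromovProduct p p x = 0 := by
  simp [gromovProduct, dist_comm]

lemma gromovProduct_self_right (p x : Z) : gromovProduct p x p = 0 := by
  simp [gromovProduct, dist_comm]

lemma gromovProduct_le_add (p q x y x' y' : Z) :
    gromovProduct p x y ≤ gromovProduct q x' y' + (dist p q + dist x x' + dist y y') := by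
  have h1 := dist_triangle4 x x' q p
  have h2 := dist_triangle4 y y' q p
  have h3 := dist_triangle4 x' x y y'
  have h4 := dist_comm p q
  have h5 := dist_comm x x'
  unfold gromovProduct
  linarith

lemma dist_sub_dist_le_gromovProduct (p x y : Z) :
    dist p x - dist x y ≤ gromovProduct p x y := by
  have h1 := dist_triangle x y p
  have h2 := dist_comm p x
  unfold gromovProduct
  linarith

lemma IsHyperbolicSpace.mono {δ δ' : ℝ} (h : IsHyperbolicSpace δ Z) (hδ : δ ≤ δ') :
    IsHyperbolicSpace δ' Z :=
  ⟨h.1, fun p x y z => (sub_le_sub_left hδ _).trans (h.2 p x y z)⟩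

/-- The four point condition: of the three sums of opposite distances, the largest two differ by
at most `2 * δ`. -/
lemma IsHyperbolicSpace.four_point {δ : ℝ} (h : IsHyperbolicSpace δ Z) (p x y z : Z) :
    dist x z + dist y p ≤ max (dist x y + dist z p) (dist y z + dist x p) + 2 * δ := by
  have := h.2 p x y z
  unfold gromovProduct at this
  rcases le_total (dist x y + dist z p) (dist y z + dist x p) with h' | h'
  · rw [max_eq_right h']
    rw [min_eq_right (by linarith)] at this
    linarith
  · rw [max_eq_left h']
    rw [min_eq_left (by linarith)] at this
    linarith

/-- The curve `c` is a geodesic segment from `x` to `y`, parametrized by arc length on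
`[0, dist x y]` (its values elsewhere are irrelevant). -/
def IsGeodesicSegment (c : ℝ → Z) (x y : Z) : Prop :=
  c 0 = x ∧ c (dist x y) = y ∧
    ∀ s ∈ Icc 0 (dist x y), ∀ t ∈ Icc 0 (dist x y), dist (c s) (c t) = |s - t|

lemma IsGeodesicSegment.gromovProduct_eq_zero {c : ℝ → Z} {x y : Z} (hc : IsGeodesicSegment c x y)
    {r s t : ℝ} (hr : 0 ≤ r) (hrs : r ≤ s) (hst : s ≤ t) (ht : t ≤ dist x y) :
    gromovProduct (c s) (c r) (c t) = 0 := by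
  have hr' : r ∈ Icc 0 (dist x y) := ⟨by linarith, by linarith⟩
  have hs' : s ∈ Icc 0 (dist x y) := ⟨by linarith, by linarith⟩
  have ht' : t ∈ Icc 0 (dist x y) := ⟨by linarith, by linarith⟩
  unfold gromovProduct
  rw [hc.2.2 r hr' s hs', hc.2.2 t ht' s hs', hc.2.2 r hr' t ht', abs_of_nonpos (by linarith),
    abs_of_nonneg (by linarith), abs_of_nonpos (by linarith)]
  ring

lemma IsGeodesicSegment.continuousOn {c : ℝ → Z} {x y : Z} (hc : IsGeodesicSegment c x y) :
    ContinuousOn c (Icc 0 (dist x y)) := by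
  have : LipschitzOnWith 1 c (Icc 0 (dist x y)) :=
    LipschitzOnWith.of_dist_le_mul fun s hs t ht => by
      rw [hc.2.2 s hs t ht, Real.dist_eq]
      simp
  exact this.continuousOn

/-- `m` is a coarse center of the triangle `a`, `b`, `x`: it is close to the three sides. -/
def IsCoarseCenter (C : ℝ) (m a b x : Z) : Prop :=
  gromovProduct m a b ≤ C ∧ gromovProduct m b x ≤ C ∧ gromovProduct m a x ≤ C

lemma IsCoarseCenter.mono {C C' : ℝ} {m a b x : Z} (h : IsCoarseCenter C m a b x) (hC : C ≤ C') :
    IsCoarseCenter C' m a b x :=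
  ⟨h.1.trans hC, h.2.1.trans hC, h.2.2.trans hC⟩

lemma IsCoarseCenter.perturb {C D : ℝ} {m a b x a' b' x' : Z} (h : IsCoarseCenter C m a b x)
    (ha : dist a a' ≤ D) (hb : dist b b' ≤ D) (hx : dist x x' ≤ D) :
    IsCoarseCenter (C + 2 * D) m a' b' x' := by
  obtain ⟨h1, h2, h3⟩ := h
  rw [dist_comm] at ha hb hx
  have hm := dist_self m
  refine ⟨?_, ?_, ?_⟩
  · linarith [gromovProduct_le_add m m a' b' a b]
  · linarith [gromovProduct_le_add m m b' x' b x]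
  · linarith [gromovProduct_le_add m m a' x' a x]

/-- A point close to the side `[a, b]` is a coarse center of the degenerate triangle it forms with
`a` and `b`. -/
lemma isCoarseCenter_self {C : ℝ} {m a b : Z} (h : gromovProduct m a b ≤ C) :
    IsCoarseCenter C m a b m := by
  have := (gromovProduct_nonneg m a b).trans h
  exact ⟨h, by rwa [gromovProduct_self_right], by rwa [gromovProduct_self_right]⟩

/-- A triangle has a coarse center on each prescribed geodesic side: the point at distance
`(b|x)_a` from `a` on the side `[a, b]`. -/
lemma IsHyperbolicSpace.exists_center {δ : ℝ} (h : IsHyperbolicSpace δ Z) {c : ℝ → Z} {a b : Z}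
    (hc : IsGeodesicSegment c a b) (x : Z) :
    ∃ t ∈ Icc 0 (dist a b), IsCoarseCenter δ (c t) a b x ∧
      dist (c t) x ≤ gromovProduct x a b + 2 * δ := by
  have hx1 := dist_triangle x a b
  have hx2 := dist_triangle a x b
  have hx3 := dist_triangle x b a
  have e1 := dist_comm x a
  have e2 := dist_comm x b
  have e3 := dist_comm b a
  set t : ℝ := gromovProduct a b x with ht
  have ht0 : 0 ≤ t := gromovProduct_nonneg _ _ _
  have htd : t ≤ dist a b := by
    rw [ht]; unfold gromovProduct; linarith
  have htm : t ∈ Icc 0 (dist a b) := ⟨ht0, htd⟩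
  have h0 : (0 : ℝ) ∈ Icc 0 (dist a b) := ⟨le_rfl, dist_nonneg⟩
  have h1 : dist a b ∈ Icc 0 (dist a b) := ⟨dist_nonneg, le_rfl⟩
  have hz := hc.gromovProduct_eq_zero le_rfl ht0 htd le_rfl
  rw [hc.1, hc.2.1] at hz
  have da : dist a (c t) = t := by
    have := hc.2.2 0 h0 t htm
    rwa [hc.1, zero_sub, abs_neg, abs_of_nonneg ht0] at this
  have db : dist b (c t) = dist a b - t := by
    have := hc.2.2 _ h1 t htm
    rwa [hc.2.1, abs_of_nonneg (by linarith)] at this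
  have key := h.2 (c t) a x b
  rw [hz] at key
  have hδ : 0 ≤ δ := by
    have := h.2 a a a a
    simp only [gromovProduct_self_left, min_self] at this
    linarith
  -- The choice of `t` makes the two other products at `c t` equal.
  have heq : gromovProduct (c t) a x = gromovProduct (c t) x b := by
    have ht' : t = (dist a b + dist a x - dist b x) / 2 := by
      rw [ht]; unfold gromovProduct; rw [e3, e1]
    unfold gromovProduct
    rw [da, db, dist_comm x b]
    linarith
  have hcomm : gromovProduct (c t) b x = gromovProduct (c t) x b := by
    unfold gromovProduct
    rw [dist_comm b x]; ring
  rw [← heq, min_self] at key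
  refine ⟨t, htm, ⟨by rw [hz]; exact hδ, by rw [hcomm, ← heq]; linarith, by linarith⟩, ?_⟩
  have hax : 2 * gromovProduct (c t) a x = t + dist x (c t) - dist a x := by
    unfold gromovProduct; rw [da]; ring
  have hxab : gromovProduct x a b = dist a x - t := by
    rw [ht]; unfold gromovProduct; rw [e1, e3, dist_comm b x]; ring
  rw [dist_comm (c t) x]
  linarith

/-- Coarse centers are unique up to a bounded distance. -/
lemma IsHyperbolicSpace.center_unique {δ C : ℝ} (h : IsHyperbolicSpace δ Z) {m m' a b x : Z}
    (hm : IsCoarseCenter C m a b x) (hm' : IsCoarseCenter C m' a b x) :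
    dist m m' ≤ 6 * C + 2 * δ := by
  obtain ⟨h1, h2, h3⟩ := hm
  obtain ⟨h1', h2', h3'⟩ := hm'
  have p1 := gromovProduct_nonneg m a b
  have p2 := gromovProduct_nonneg m b x
  have p3 := gromovProduct_nonneg m a x
  have q1 := gromovProduct_nonneg m' a b
  have q2 := gromovProduct_nonneg m' b x
  have q3 := gromovProduct_nonneg m' a x
  have key := h.four_point m' a m b
  unfold gromovProduct at *
  have e1 := dist_comm b m
  rcases max_cases (dist a m + dist b m') (dist m b + dist a m') with ⟨h5, -⟩ | ⟨h5, -⟩ <;>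
  · rw [h5] at key
    linarith

lemma IsHyperbolicSpace.exists_isCoarseCenter {δ : ℝ} (h : IsHyperbolicSpace δ Z) (a b x : Z) :
    ∃ m, IsCoarseCenter δ m a b x := by
  obtain ⟨c, hc⟩ := h.1 a b
  obtain ⟨t, -, ht, -⟩ := h.exists_center hc x
  exact ⟨_, ht⟩

end GromovProduct

/-! ### Coarse Lipschitz retracts are quasiconvex -/

section Retract

/-- Gromov products along a chain of `n ≤ 2 ^ k` steps: the loss is only logarithmic in `n`. -/
lemma IsHyperbolicSpace.chain {Z : Type*} [MetricSpace Z] {δ : ℝ} (h : IsHyperbolicSpace δ Z)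
    (p : Z) (r : ℝ) (k : ℕ) :
    ∀ (z : ℕ → Z), (∀ i < 2 ^ k, r ≤ gromovProduct p (z i) (z (i + 1))) →
      r - k * δ ≤ gromovProduct p (z 0) (z (2 ^ k)) := by
  induction k with
  | zero =>
    intro z hz
    simpa using hz 0 (by simp)
  | succ k ih =>
    intro z hz
    have h1 := ih z fun i hi => hz i (by rw [pow_succ]; omega)
    have h2 := ih (fun i => z (2 ^ k + i)) fun i hi => hz (2 ^ k + i) (by rw [pow_succ]; omega)
    have h3 := h.2 p (z 0) (z (2 ^ k)) (z (2 ^ (k + 1)))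
    have e : 2 ^ k + 2 ^ k = 2 ^ (k + 1) := by rw [pow_succ]; omega
    simp only [add_zero, e] at h2
    have := le_min h1 h2
    push_cast
    linarith

/-- A quantity bounded by the logarithm of an affine function of itself is bounded. -/
lemma exists_bound_of_le_log {A B α δ : ℝ} (hA : 0 < A) :
    ∃ R : ℝ, ∀ D : ℝ, (∀ k : ℕ, A * D + B ≤ 2 ^ k → D ≤ α + k * δ) → D ≤ R := by
  have hlim : Tendsto (fun k : ℕ => (A * (α + δ) + B) * ((k : ℝ) ^ 0 / 2 ^ k)
      + (A * δ) * ((k : ℝ) ^ 1 / 2 ^ k)) atTop (𝓝 ((A * (α + δ) + B) * 0 + (A * δ) * 0)) :=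
    ((tendsto_pow_const_div_const_pow_of_one_lt 0 one_lt_two).const_mul _).add
      ((tendsto_pow_const_div_const_pow_of_one_lt 1 one_lt_two).const_mul _)
  have hev := hlim.eventually (gt_mem_nhds (show (A * (α + δ) + B) * 0 + (A * δ) * 0 < (1 : ℝ) by
    norm_num))
  obtain ⟨k₀, hk₀⟩ := eventually_atTop.1 hev
  have hk : ∀ k ≥ k₀, A * (α + ((k : ℝ) + 1) * δ) + B ≤ 2 ^ k := by
    intro k hk
    have h2 : (0 : ℝ) < 2 ^ k := by positivity
    have h1 := hk₀ k hk
    rw [pow_zero, pow_one, mul_div_assoc', mul_div_assoc', ← add_div, div_lt_one h2] at h1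
    nlinarith
  refine ⟨α + k₀ * δ, fun D hD => ?_⟩
  by_contra! hlt
  -- Each bound `D > α + k * δ` improves itself to the next one.
  have hall : ∀ k ≥ k₀, α + k * δ < D := by
    intro k hk'
    induction k, hk' using Nat.le_induction with
    | base => exact hlt
    | succ k hk' ih =>
      have h1 : 2 ^ k < A * D + B := by
        by_contra! h
        linarith [hD k h]
      have h2 := hk k hk'
      have h3 : A * (α + ((k : ℝ) + 1) * δ) < A * D := by linarith
      push_cast
      exact lt_of_mul_lt_mul_left h3 hA.le
  obtain ⟨n, hn⟩ := pow_unbounded_of_one_lt (A * D + B) (one_lt_two (α := ℝ))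
  have h1 : (2 : ℝ) ^ n ≤ 2 ^ (max n k₀) := pow_le_pow_right₀ (by norm_num) (le_max_left _ _)
  linarith [hD (max n k₀) (by linarith), hall (max n k₀) (le_max_right _ _)]

/-- The image of a coarse Lipschitz retraction of a hyperbolic space is quasiconvex, with a
constant depending on the constants of the space and of the retraction only. If a geodesic goes
far away from the image, to distance `D` say, then the projection of a segment of the geodesic of
length comparable to `D` is a path that avoids a ball of radius `D` and whose length is linear
in `D`, whereas hyperbolicity requires an exponential length. -/
theorem exists_dist_retraction_le (δ L : ℝ) :
    ∃ R : ℝ, ∀ (Z : Type u) [MetricSpace Z], IsHyperbolicSpace δ Z → ∀ π : Z → Z,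
      (∀ x y, dist (π x) (π y) ≤ L * dist x y + L) → (∀ x, dist (π (π x)) (π x) ≤ L) →
      ∀ (x y : Z) (c : ℝ → Z), IsGeodesicSegment c x y → dist (π x) x ≤ L → dist (π y) y ≤ L →
        ∀ t ∈ Icc 0 (dist x y), ∃ z, dist (c t) (π z) ≤ R := by
  by_cases hL : 0 ≤ L
  swap
  · refine ⟨0, fun Z _ _ π _ _ x y c _ hx => ?_⟩
    exact absurd (dist_nonneg.trans hx) hL
  obtain ⟨R, hR⟩ := exists_bound_of_le_log (A := 2 * (2 + L)) (B := 2 * (1 + 3 * L))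
    (α := 2 * L + 2 * δ) (δ := δ) (by linarith)
  refine ⟨R + 1, fun Z _ hZ π hπ hππ x y c hc hx hy t ht => ?_⟩
  have hδ : 0 ≤ δ := by
    have := hZ.2 x x x x
    simp only [gromovProduct_self_left, min_self] at this
    linarith
  have hne : (range π).Nonempty := ⟨_, mem_range_self x⟩
  obtain ⟨t₀, ht₀, hmax⟩ := isCompact_Icc.exists_isMaxOn ⟨t, ht⟩
    ((Metric.continuous_infDist_pt (range π)).comp_continuousOn hc.continuousOn)
  set D := Metric.infDist (c t₀) (range π) with hD
  have hD0 : 0 ≤ D := Metric.infDist_nonneg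
  have hle : ∀ u ∈ Icc 0 (dist x y), Metric.infDist (c u) (range π) ≤ D := fun u hu => hmax hu
  have hclose : ∀ u ∈ Icc 0 (dist x y), ∃ z, dist (c u) (π z) < D + 1 := by
    intro u hu
    obtain ⟨w, ⟨z, rfl⟩, hz⟩ := (Metric.infDist_lt_iff hne).1
      (lt_of_le_of_lt (hle u hu) (lt_add_one D))
    exact ⟨z, hz⟩
  have hfar : ∀ z, D ≤ dist (c t₀) (π z) := fun z =>
    Metric.infDist_le_dist_of_mem (mem_range_self z)
  have hself : ∀ u ∈ Icc 0 (dist x y), dist (c u) (π (c u)) ≤ (1 + L) * D + (1 + 3 * L) := by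
    intro u hu
    obtain ⟨z, hz⟩ := hclose u hu
    have h1 := hππ z
    have h2 := hπ (π z) (c u)
    rw [dist_comm (π z) (c u)] at h2
    have h3 := dist_triangle4 (c u) (π z) (π (π z)) (π (c u))
    rw [dist_comm (π z) (π (π z))] at h3
    have h4 : L * dist (c u) (π z) ≤ L * (D + 1) := mul_le_mul_of_nonneg_left hz.le hL
    linarith
  suffices hDR : D ≤ R by
    obtain ⟨z, hz⟩ := hclose t ht
    exact ⟨z, by linarith⟩
  refine hR D fun k hk => ?_
  set S : ℝ := (2 + L) * D + (1 + 3 * L) with hS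
  have hLD : 0 ≤ L * D := mul_nonneg hL hD0
  have hS0 : 0 ≤ S := by rw [hS]; linarith
  have hSk : 2 * S ≤ 2 ^ k := by rw [hS]; linarith
  set s₁ := max 0 (t₀ - S) with hs₁
  set s₂ := min (dist x y) (t₀ + S) with hs₂
  have hs₁0 : 0 ≤ s₁ := le_max_left _ _
  have hs₁t : s₁ ≤ t₀ := max_le ht₀.1 (by linarith)
  have hts₂ : t₀ ≤ s₂ := le_min ht₀.2 (by linarith)
  have hs₂d : s₂ ≤ dist x y := min_le_left _ _
  have hs₁m : s₁ ∈ Icc 0 (dist x y) := ⟨hs₁0, by linarith⟩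
  have hs₂m : s₂ ∈ Icc 0 (dist x y) := ⟨by linarith, hs₂d⟩
  have hlen : s₂ ≤ s₁ + 2 ^ k := by
    have h1 : t₀ - S ≤ s₁ := le_max_right _ _
    have h2 : s₂ ≤ t₀ + S := min_le_right _ _
    linarith
  -- At each end, the geodesic and its projection have a large product seen from `c t₀`: the end
  -- is an end of the whole geodesic, or it is much farther from `c t₀` than from its projection.
  have hend : ∀ u ∈ Icc 0 (dist x y), (dist (π (c u)) (c u) ≤ L ∨ |t₀ - u| = S) →
      D - L ≤ gromovProduct (c t₀) (π (c u)) (c u) := by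
    rintro u hu (h | h)
    · have := dist_sub_dist_le_gromovProduct (c t₀) (π (c u)) (c u)
      linarith [hfar (c u)]
    · have h1 := dist_sub_dist_le_gromovProduct (c t₀) (c u) (π (c u))
      have h2 : gromovProduct (c t₀) (c u) (π (c u)) = gromovProduct (c t₀) (π (c u)) (c u) := by
        unfold gromovProduct
        rw [dist_comm (c u) (π (c u))]; ring
      rw [hc.2.2 t₀ ht₀ u hu, h, h2] at h1
      linarith [hself u hu]
  have hend₁ : D - L ≤ gromovProduct (c t₀) (π (c s₁)) (c s₁) := by
    refine hend s₁ hs₁m ?_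
    rcases le_total (t₀ - S) 0 with h | h
    · left
      rw [hs₁, max_eq_left h, hc.1]
      exact hx
    · right
      rw [hs₁, max_eq_right h, sub_sub_cancel, abs_of_nonneg hS0]
  have hend₂ : D - L ≤ gromovProduct (c t₀) (π (c s₂)) (c s₂) := by
    refine hend s₂ hs₂m ?_
    rcases le_total (dist x y) (t₀ + S) with h | h
    · left
      rw [hs₂, min_eq_left h, hc.2.1]
      exact hy
    · right
      rw [hs₂, min_eq_right h, sub_add_cancel_left, abs_neg, abs_of_nonneg hS0]
  have hchain := hZ.chain (c t₀) (D - 2 * L) k (fun i => π (c (min s₂ (s₁ + i)))) (by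
    intro i _
    have hm : ∀ j : ℕ, min s₂ (s₁ + j) ∈ Icc 0 (dist x y) := fun j =>
      ⟨le_min (by linarith) (by positivity), (min_le_left _ _).trans hs₂d⟩
    have h1 := dist_sub_dist_le_gromovProduct (c t₀) (π (c (min s₂ (s₁ + i))))
      (π (c (min s₂ (s₁ + (i + 1 : ℕ)))))
    have h2 := hπ (c (min s₂ (s₁ + i))) (c (min s₂ (s₁ + (i + 1 : ℕ))))
    rw [hc.2.2 _ (hm i) _ (hm (i + 1))] at h2
    have h3 : |min s₂ (s₁ + i) - min s₂ (s₁ + (i + 1 : ℕ))| ≤ 1 := by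
      have := abs_min_sub_min_le_max s₂ (s₁ + i) s₂ (s₁ + (i + 1 : ℕ))
      refine this.trans (max_le (by simp) ?_)
      push_cast
      rw [show s₁ + (i : ℝ) - (s₁ + (i + 1)) = -1 by ring]
      simp
    have h4 : L * |min s₂ (s₁ + i) - min s₂ (s₁ + (i + 1 : ℕ))| ≤ L * 1 :=
      mul_le_mul_of_nonneg_left h3 hL
    linarith [hfar (c (min s₂ (s₁ + i)))])
  simp only [Nat.cast_zero, add_zero, Nat.cast_pow, Nat.cast_ofNat] at hchain
  rw [min_eq_right (by linarith : s₁ ≤ s₂), min_eq_left hlen] at hchain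
  have hz := hc.gromovProduct_eq_zero hs₁0 hs₁t hts₂ hs₂d
  have h1 := hZ.2 (c t₀) (c s₁) (π (c s₁)) (c s₂)
  have h2 := hZ.2 (c t₀) (π (c s₁)) (π (c s₂)) (c s₂)
  have hcomm : gromovProduct (c t₀) (c s₁) (π (c s₁)) = gromovProduct (c t₀) (π (c s₁)) (c s₁) := by
    unfold gromovProduct
    rw [dist_comm (c s₁) (π (c s₁))]; ring
  have hkδ : 0 ≤ k * δ := by positivity
  rw [hz, hcomm] at h1
  have h3 : D - 2 * L - k * δ ≤ min (gromovProduct (c t₀) (π (c s₁)) (π (c s₂)))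
      (gromovProduct (c t₀) (π (c s₂)) (c s₂)) := le_min (by linarith) (by linarith)
  have h4 : D - 2 * L - k * δ - δ ≤ min (gromovProduct (c t₀) (π (c s₁)) (c s₁))
      (gromovProduct (c t₀) (π (c s₁)) (c s₂)) := le_min (by linarith) (by linarith)
  linarith

end Retract

/-! ### Coarse correspondences -/

section Correspondence

/-- A coarse correspondence: a relation under which each point has a partner on the other side,
and which distorts distances in a controlled way in both directions. These are the quasi-isometries,
in a form that does not distinguish between a map and its quasi-inverse. -/
def IsCoarseCorrespondence {A B : Type*} [MetricSpace A] [MetricSpace B] (K : ℝ)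
    (R : A → B → Prop) : Prop :=
  (∀ a, ∃ b, R a b) ∧ (∀ b, ∃ a, R a b) ∧ ∀ a b a' b', R a b → R a' b' →
    dist b b' ≤ K * dist a a' + K ∧ dist a a' ≤ K * dist b b' + K

lemma IsCoarseCorrespondence.swap {A B : Type*} [MetricSpace A] [MetricSpace B] {K : ℝ}
    {R : A → B → Prop} (h : IsCoarseCorrespondence K R) :
    IsCoarseCorrespondence K (fun b a => R a b) :=
  ⟨h.2.1, h.1, fun b a b' a' hab hab' => (h.2.2 a b a' b' hab hab').symm⟩

/-- A coarse correspondence between hyperbolic spaces sends points close to a geodesic `[a, b]` to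
points close to the geodesic between the images `a'`, `b'` of `a` and `b`. Indeed, pulling back the
projection to `[a', b']` yields a coarse Lipschitz retraction, whose image is therefore
quasiconvex. -/
theorem exists_gromovProduct_le_of_correspondence (δ K C : ℝ) :
    ∃ C' : ℝ, ∀ (A : Type u) (B : Type v) [MetricSpace A] [MetricSpace B],
      IsHyperbolicSpace δ A → IsHyperbolicSpace δ B →
      ∀ R : A → B → Prop, IsCoarseCorrespondence K R →
      ∀ a b m a' b' m', R a a' → R b b' → R m m' →
        gromovProduct m a b ≤ C → gromovProduct m' a' b' ≤ C' := by
  obtain ⟨ρ, hρ⟩ := exists_dist_retraction_le.{u} δ (12 * K ^ 2 + 8 * K * δ + K)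
  refine ⟨δ + (K * (6 * C + 8 * δ + ρ) + K), ?_⟩
  intro A B _ _ hA hB R hR a b m a' b' m' ha hb hm hC
  have hC0 : 0 ≤ C := (gromovProduct_nonneg _ _ _).trans hC
  have hδ : 0 ≤ δ := by
    have := hA.2 a a a a
    simp only [gromovProduct_self_left, min_self] at this
    linarith
  have hdist := hR.2.2
  have hK : 0 ≤ K := by
    have := (hdist a a' a a' ha ha).1
    simpa using this
  choose f hf using hR.1
  choose g hg using hR.2.1
  choose n hn using hB.exists_isCoarseCenter a' b'
  have hn' : ∀ y D z, dist y z ≤ D → IsCoarseCenter (δ + 2 * D) (n y) a' b' z := by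
    intro y D z hyz
    have hD : 0 ≤ D := dist_nonneg.trans hyz
    exact (hn y).perturb (by simpa using hD) (by simpa using hD) hyz
  have hfix : ∀ y z, gromovProduct z a' b' ≤ δ → dist y z ≤ K → dist (n y) z ≤ 8 * δ + 12 * K := by
    intro y z hz hyz
    have h1 := hB.center_unique (hn' y K z hyz)
      ((isCoarseCenter_self hz).mono (show δ ≤ δ + 2 * K by linarith))
    linarith
  have hgm : ∀ p x y, R x y → dist p y ≤ 8 * δ + 12 * K →
      dist (g p) x ≤ 12 * K ^ 2 + 8 * K * δ + K := by
    intro p x y hxy hp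
    have h1 := (hdist _ _ _ _ (hg p) hxy).2
    have h2 := mul_le_mul_of_nonneg_left hp hK
    linarith
  obtain ⟨c, hc⟩ := hA.1 a b
  obtain ⟨t, ht, hct, -⟩ := hA.exists_center hc m
  obtain ⟨z, hz⟩ := hρ A hA (fun x => g (n (f x))) (by
      intro x y
      have h1 := (hdist _ _ _ _ (hf x) (hf y)).1
      have h2 := hB.center_unique (hn' (f x) (dist (f x) (f y)) (f y) le_rfl)
        ((hn (f y)).mono (le_add_of_nonneg_right (by positivity)))
      have h3 := (hdist _ _ _ _ (hg (n (f x))) (hg (n (f y)))).2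
      have h4 := mul_le_mul_of_nonneg_left h1 hK
      have h5 := mul_le_mul_of_nonneg_left h2 hK
      have h6 : 0 ≤ (8 * K * δ + K) * dist x y := by positivity
      linarith) (by
      intro x
      refine hgm _ _ _ (hg _) (hfix _ _ (hn (f x)).1 ?_)
      have := (hdist _ _ _ _ (hf (g (n (f x)))) (hg (n (f x)))).1
      simpa using this) a b c hc (by
      refine hgm _ _ _ ha (hfix _ _ ?_ ?_)
      · rwa [gromovProduct_self_left]
      · have := (hdist _ _ _ _ (hf a) ha).1
        simpa using this) (by
      refine hgm _ _ _ hb (hfix _ _ ?_ ?_)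
      · rwa [gromovProduct_self_right]
      · have := (hdist _ _ _ _ (hf b) hb).1
        simpa using this) t ht
  have h1 := hA.center_unique ((isCoarseCenter_self hC).mono (show C ≤ C + δ by linarith))
    (hct.mono (show δ ≤ C + δ by linarith))
  have h2 : dist m (g (n (f z))) ≤ 6 * C + 8 * δ + ρ := by
    linarith [dist_triangle m (c t) (g (n (f z)))]
  have h3 := (hdist _ _ _ _ hm (hg (n (f z)))).1
  have h4 := gromovProduct_le_add m' (n (f z)) a' b' a' b'
  rw [dist_self, dist_self] at h4
  have h5 := mul_le_mul_of_nonneg_left h2 hK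
  linarith [(hn (f z)).1]

end Correspondence

/-! ### Coarse stacks of hyperbolic spaces -/

section Stack

/-- A coarse stack: a metric space `X` that is coarsely the union of levels `Y j`, in which
consecutive levels are related by uniform coarse correspondences. Levels may be empty, but if the
level `j` is not, neither is the level `j + 1`. Each point of `X` has a floor, which is a point of
some level; the floors of close points are close, or they lie in consecutive levels and correspond
to each other. -/
structure CoarseStack (X : Type*) [MetricSpace X] (Y : ℤ → Type*) [∀ j, MetricSpace (Y j)]
    (K : ℝ) where
  /-- the inclusion of a level -/
  incl : ∀ j, Y j → X
  dist_incl_le : ∀ j y y', dist (incl j y) (incl j y') ≤ dist y y'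
  abs_le_dist : ∀ (j : ℤ) y y₀, |(j : ℝ)| ≤ dist (incl j y) (incl 0 y₀)
  /-- the correspondence between consecutive levels -/
  adj : ∀ j, Y j → Y (j + 1) → Prop
  adj_correspondence : ∀ j, Nonempty (Y j) → IsCoarseCorrespondence K (adj j)
  dist_le_of_adj : ∀ j y y', adj j y y' → dist (incl j y) (incl (j + 1) y') ≤ K
  /-- the relation between a point of `X` and its floor -/
  floor : ∀ j, Y j → X → Prop
  exists_floor : ∀ x, ∃ j y, floor j y x
  floor_incl : ∀ j y, floor j y (incl j y)
  level_eq : ∀ x j y j' y', floor j y x → floor j' y' x → j' = j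
  level_near : ∀ x x', dist x x' < 1 / 2 → ∀ j y j' y', floor j y x → floor j' y' x' →
    j' = j ∨ j' = j + 1 ∨ j = j' + 1
  dist_floor_le : ∀ x x', dist x x' < 1 / 2 → ∀ j y y', floor j y x → floor j y' x' →
    dist y y' ≤ K
  adj_floor : ∀ x x', dist x x' < 1 / 2 → ∀ j y y', floor j y x → floor (j + 1) y' x' →
    adj j y y'

variable {X : Type*} [MetricSpace X] {Y : ℤ → Type u} [∀ j, MetricSpace (Y j)] {K : ℝ}

/-- A map that is controlled at a definite small scale is coarse Lipschitz on a geodesic space. -/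
lemma IsGeodesicSpace.dist_le_of_local {W : Type*} [MetricSpace W]
    (hX : IsGeodesicSpace X) {L : ℝ} (hL : 0 ≤ L) {π : X → W}
    (hπ : ∀ x y, dist x y < 1 / 2 → dist (π x) (π y) ≤ L) (x y : X) :
    dist (π x) (π y) ≤ 4 * L * dist x y + L := by
  obtain ⟨c, hc⟩ := hX x y
  have key : ∀ n : ℕ, ∀ t ∈ Icc 0 (dist x y), t ≤ n / 4 → dist (π x) (π (c t)) ≤ n * L := by
    intro n
    induction n with
    | zero =>
      intro t ht htn
      have ht0 : t = 0 := le_antisymm (by simpa using htn) ht.1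
      have := hc.1
      simp [ht0, this]
    | succ n ih =>
      intro t ht htn
      have ht' : max 0 (t - 1 / 4) ∈ Icc 0 (dist x y) :=
        ⟨le_max_left _ _, max_le dist_nonneg (by linarith [ht.2])⟩
      have hd : dist (c (max 0 (t - 1 / 4))) (c t) < 1 / 2 := by
        rw [hc.2.2 _ ht' t ht, abs_of_nonpos (by
          rw [sub_nonpos]; exact max_le ht.1 (by linarith))]
        linarith [le_max_right 0 (t - 1 / 4)]
      push_cast at htn ⊢
      have h1 := ih _ ht' (max_le (by positivity) (by linarith))
      linarith [hπ _ _ hd, dist_triangle (π x) (π (c (max 0 (t - 1 / 4)))) (π (c t))]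
  have h1 := key ⌈4 * dist x y⌉₊ _ ⟨dist_nonneg, le_rfl⟩ (by linarith [Nat.le_ceil (4 * dist x y)])
  rw [hc.2.1] at h1
  have h2 := Nat.ceil_lt_add_one (show 0 ≤ 4 * dist x y by positivity)
  have h3 := mul_le_mul_of_nonneg_right h2.le hL
  linarith

namespace CoarseStack

variable (S : CoarseStack X Y K)

/-- A section chooses a point in each nonempty level, in such a way that the points chosen in
consecutive levels correspond to each other. -/
def IsSection (σ : ∀ j, Nonempty (Y j) → Y j) : Prop :=
  ∀ j h h', S.adj j (σ j h) (σ (j + 1) h')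

lemma nonempty_succ (S : CoarseStack X Y K) {j : ℤ} (h : Nonempty (Y j)) : Nonempty (Y (j + 1)) := by
  obtain ⟨y⟩ := h
  exact ((S.adj_correspondence j ⟨y⟩).1 y).nonempty

lemma nonempty_natCast (S : CoarseStack X Y K) (h : Nonempty (Y 0)) (k : ℕ) : Nonempty (Y k) := by
  induction k with
  | zero => exact h
  | succ k ih => exact S.nonempty_succ ih

lemma exists_section (a : Y 0) : ∃ σ, S.IsSection σ ∧ ∀ h, σ 0 h = a := by
  have hup : ∀ j (y : Y j), ∃ y', S.adj j y y' := fun j y => (S.adj_correspondence j ⟨y⟩).1 y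
  have hdown : ∀ j (_ : Nonempty (Y j)) (y' : Y (j + 1)), ∃ y, S.adj j y y' := fun j h y' =>
    (S.adj_correspondence j h).2.1 y'
  choose up hup using hup
  choose down hdown using hdown
  let pos : ∀ k : ℕ, Y (Int.ofNat k) := fun k => Nat.rec a (fun k y => up (Int.ofNat k) y) k
  let neg : ∀ k : ℕ, Nonempty (Y (Int.negSucc k)) → Y (Int.negSucc k) := fun k =>
    Nat.rec (fun h => down (Int.negSucc 0) h a)
      (fun k f h => down (Int.negSucc (k + 1)) h (f (S.nonempty_succ h))) k
  let σ : ∀ j, Nonempty (Y j) → Y j := fun j => match j with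
    | Int.ofNat k => fun _ => pos k
    | Int.negSucc k => neg k
  refine ⟨σ, ?_, fun h => rfl⟩
  rintro (k | k) h h'
  · exact hup _ _
  · cases k with
    | zero => exact hdown _ _ _
    | succ k => exact hdown _ _ _

/-- The level `Y 0` is properly embedded in `X`: a path in `X` is compared with the section through
its initial point, from which it deviates at most exponentially. -/
lemma exists_dist_le_of_dist_incl_le (hX : IsGeodesicSpace X) (r : ℝ) :
    ∃ H : ℝ, ∀ x y : Y 0, dist (S.incl 0 x) (S.incl 0 y) ≤ r → dist x y ≤ H := by
  have key : ∀ n : ℕ, ∃ H : ℝ, ∀ (x : Y 0) σ, S.IsSection σ → (∀ h, σ 0 h = x) →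
      ∀ (z : X) c, IsGeodesicSegment c (S.incl 0 x) z → ∀ t ∈ Icc 0 (dist (S.incl 0 x) z),
        t ≤ n / 4 → ∀ j y h, S.floor j y (c t) → dist y (σ j h) ≤ H := by
    intro n
    induction n with
    | zero =>
      refine ⟨K, fun x σ _ hσ z c hc t ht htn j y h hy => ?_⟩
      have ht0 : t = 0 := le_antisymm (by simpa using htn) ht.1
      rw [ht0, hc.1] at hy
      obtain rfl := S.level_eq _ _ _ _ _ (S.floor_incl 0 x) hy
      rw [hσ]
      exact S.dist_floor_le _ _ (by rw [dist_self]; norm_num) _ _ _ hy (S.floor_incl 0 x)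
    | succ n ih =>
      obtain ⟨H, hH⟩ := ih
      refine ⟨max (K + H) (K * H + K), fun x σ hσ hσx z c hc t ht htn j y h hy => ?_⟩
      have ht' : max 0 (t - 1 / 4) ∈ Icc 0 (dist (S.incl 0 x) z) :=
        ⟨le_max_left _ _, max_le dist_nonneg (by linarith [ht.2])⟩
      obtain ⟨j', y', hy'⟩ := S.exists_floor (c (max 0 (t - 1 / 4)))
      have hn' : max 0 (t - 1 / 4) ≤ n / 4 := by
        push_cast at htn
        exact max_le (by positivity) (by linarith)
      have h1 := hH x σ hσ hσx z c hc _ ht' hn' j' y' ⟨y'⟩ hy'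
      have hd : dist (c (max 0 (t - 1 / 4))) (c t) < 1 / 2 := by
        rw [hc.2.2 _ ht' t ht, abs_of_nonpos (by
          rw [sub_nonpos]; exact max_le ht.1 (by linarith))]
        linarith [le_max_right 0 (t - 1 / 4)]
      have hKH : ∀ {A B : Type u} [MetricSpace A] [MetricSpace B] (R : A → B → Prop),
          IsCoarseCorrespondence K R → ∀ a b a' b', R a b → R a' b' → dist a a' ≤ H →
          dist b b' ≤ K * H + K := by
        intro A B _ _ R hR a b a' b' hab hab' hH
        have hK : 0 ≤ K := by
          have := (hR.2.2 _ _ _ _ hab hab).1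
          simpa using this
        have := (hR.2.2 _ _ _ _ hab hab').1
        have := mul_le_mul_of_nonneg_left hH hK
        linarith
      rcases S.level_near _ _ hd _ _ _ _ hy' hy with rfl | rfl | rfl
      · have h2 := S.dist_floor_le _ _ hd _ _ _ hy' hy
        refine le_trans ?_ (le_max_left _ _)
        linarith [dist_triangle_left y (σ j h) y']
      · have h2 := S.adj_floor _ _ hd _ _ _ hy' hy
        exact (hKH _ (S.adj_correspondence j' ⟨y'⟩) _ _ _ _ h2 (hσ j' ⟨y'⟩ h) h1).trans
          (le_max_right _ _)
      · have h2 := S.adj_floor _ _ (by rwa [dist_comm]) _ _ _ hy hy'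
        exact (hKH _ (S.adj_correspondence j h).swap _ _ _ _ h2 (hσ j h ⟨y'⟩) h1).trans
          (le_max_right _ _)
  obtain ⟨H, hH⟩ := key ⌈4 * r⌉₊
  refine ⟨H, fun x y hxy => ?_⟩
  obtain ⟨σ, hσ, hσx⟩ := S.exists_section x
  obtain ⟨c, hc⟩ := hX (S.incl 0 x) (S.incl 0 y)
  have h1 := hH x σ hσ hσx (S.incl 0 y) c hc _ ⟨dist_nonneg, le_rfl⟩
    (by linarith [Nat.le_ceil (4 * r)]) 0 y ⟨y⟩ (by
      have := hc.2.1
      rw [this]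
      exact S.floor_incl 0 y)
  rwa [hσx, dist_comm] at h1

/-- The ladder spanned by two sections `σ` and `τ`, which consists of the points of the levels
`Y j` close to a geodesic from `σ j` to `τ j`, is a coarse Lipschitz retract of `X`: in each level,
project to the geodesic. The projections in consecutive levels agree because correspondences
preserve coarse centers. -/
lemma exists_ladder_retraction {δ : ℝ} (hδ : 0 ≤ δ) (hK : 0 ≤ K) (hX : IsGeodesicSpace X)
    (hY : ∀ j, IsHyperbolicSpace δ (Y j)) :
    ∃ L : ℝ, ∀ σ τ, S.IsSection σ → S.IsSection τ → ∃ π : X → X,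
      (∀ x y, dist (π x) (π y) ≤ L * dist x y + L) ∧
      (∀ x, ∃ j h m, π x = S.incl j m ∧ gromovProduct m (σ j h) (τ j h) ≤ δ) ∧
      ∀ j h m, gromovProduct m (σ j h) (τ j h) ≤ δ → dist (π (S.incl j m)) (S.incl j m) ≤ L := by
  obtain ⟨C, hC⟩ := exists_gromovProduct_le_of_correspondence.{u, u} δ K δ
  set L := max (8 * δ + 12 * K) (K + (6 * max C δ + 2 * δ)) with hL
  have hL₁ : 8 * δ + 12 * K ≤ L := le_max_left _ _
  have hL₂ : K + (6 * max C δ + 2 * δ) ≤ L := le_max_right _ _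
  have hL0 : 0 ≤ L := by linarith
  refine ⟨4 * L, fun σ τ hσ hτ => ?_⟩
  choose ctr hctr using fun j => (hY j).exists_isCoarseCenter
  have hπ : ∀ x, ∃ w, ∃ j h y, S.floor j y x ∧ w = S.incl j (ctr j (σ j h) (τ j h) y) := by
    intro x
    obtain ⟨j, y, hy⟩ := S.exists_floor x
    exact ⟨_, j, ⟨y⟩, y, hy, rfl⟩
  choose π hπ using hπ
  have hclose : ∀ j (a b y y' m : Y j), dist y y' ≤ K → IsCoarseCenter δ m a b y' →
      dist (ctr j a b y) m ≤ L := by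
    intro j a b y y' m hy hm
    have h1 := (hctr j a b y).perturb (a' := a) (b' := b) (D := K) (by simpa using hK)
      (by simpa using hK) hy
    have h2 := (hY j).center_unique h1 (hm.mono (by linarith))
    linarith
  have hstep : ∀ x x' j h h' y y', dist x x' < 1 / 2 → S.floor j y x → S.floor (j + 1) y' x' →
      dist (S.incl j (ctr j (σ j h) (τ j h) y))
        (S.incl (j + 1) (ctr (j + 1) (σ (j + 1) h') (τ (j + 1) h') y')) ≤ L := by
    intro x x' j h h' y y' hx hy hy'
    have hR := S.adj_correspondence j h
    have hyy' := S.adj_floor _ _ hx _ _ _ hy hy'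
    have hσσ := hσ j h h'
    have hττ := hτ j h h'
    obtain ⟨h1, h2, h3⟩ := hctr j (σ j h) (τ j h) y
    obtain ⟨m, hm⟩ := hR.1 (ctr j (σ j h) (τ j h) y)
    have hm' : IsCoarseCenter C m (σ (j + 1) h') (τ (j + 1) h') y' :=
      ⟨hC _ _ (hY j) (hY (j + 1)) _ hR _ _ _ _ _ _ hσσ hττ hm h1,
        hC _ _ (hY j) (hY (j + 1)) _ hR _ _ _ _ _ _ hττ hyy' hm h2,
        hC _ _ (hY j) (hY (j + 1)) _ hR _ _ _ _ _ _ hσσ hyy' hm h3⟩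
    have h4 := (hY (j + 1)).center_unique (hm'.mono (le_max_left C δ))
      ((hctr (j + 1) (σ (j + 1) h') (τ (j + 1) h') y').mono (le_max_right C δ))
    have h5 := S.dist_le_of_adj _ _ _ hm
    have h6 := S.dist_incl_le (j + 1) m (ctr (j + 1) (σ (j + 1) h') (τ (j + 1) h') y')
    linarith [dist_triangle (S.incl j (ctr j (σ j h) (τ j h) y)) (S.incl (j + 1) m)
      (S.incl (j + 1) (ctr (j + 1) (σ (j + 1) h') (τ (j + 1) h') y'))]
  refine ⟨π, fun x y => ?_, fun x => ?_, fun j h m hm => ?_⟩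
  · have := hX.dist_le_of_local hL0 (π := π) (fun x x' hx => by
      obtain ⟨j, h, y, hy, e⟩ := hπ x
      obtain ⟨j', h', y', hy', e'⟩ := hπ x'
      rw [e, e']
      rcases S.level_near _ _ hx _ _ _ _ hy hy' with rfl | rfl | rfl
      · exact (S.dist_incl_le _ _ _).trans
          (hclose _ _ _ _ _ _ (S.dist_floor_le _ _ hx _ _ _ hy hy') (hctr _ _ _ _))
      · exact hstep _ _ _ _ _ _ _ hx hy hy'
      · rw [dist_comm]
        exact hstep _ _ _ _ _ _ _ (by rwa [dist_comm]) hy' hy) x y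
    linarith
  · obtain ⟨j, h, y, hy, e⟩ := hπ x
    exact ⟨j, h, _, e, (hctr _ _ _ _).1⟩
  · obtain ⟨j', h', y, hy, e⟩ := hπ (S.incl j m)
    obtain rfl := S.level_eq _ _ _ _ _ (S.floor_incl j m) hy
    rw [e]
    have h1 := S.dist_floor_le _ _ (by rw [dist_self]; norm_num) _ _ _ hy (S.floor_incl _ m)
    have h2 := hclose _ _ _ _ _ _ h1 (isCoarseCenter_self hm)
    linarith [S.dist_incl_le _ (ctr j' (σ j' h') (τ j' h') y) m]

/-- Each point of a ladder is joined to the level `0` of the ladder by a path in the ladder that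
moves steadily through the levels: move to the next level by a correspondence, project to the
ladder, and iterate. -/
lemma exists_ladder_path {δ : ℝ} (hY : ∀ j, IsHyperbolicSpace δ (Y j))
    (h₀ : Nonempty (Y 0)) :
    ∃ C : ℝ, ∀ σ τ, S.IsSection σ → S.IsSection τ →
      ∀ (j : ℤ) h m, gromovProduct m (σ j h) (τ j h) ≤ δ →
        ∃ m₀, gromovProduct m₀ (σ 0 h₀) (τ 0 h₀) ≤ δ ∧
          dist (S.incl j m) (S.incl 0 m₀) ≤ C * |(j : ℝ)| := by
  obtain ⟨C, hC⟩ := exists_gromovProduct_le_of_correspondence.{u, u} δ K δ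
  refine ⟨K + (6 * max C δ + 2 * δ), fun σ τ hσ hτ => ?_⟩
  have hproj : ∀ j h (m : Y j), gromovProduct m (σ j h) (τ j h) ≤ C →
      ∃ m', gromovProduct m' (σ j h) (τ j h) ≤ δ ∧
        dist (S.incl j m) (S.incl j m') ≤ 6 * max C δ + 2 * δ := by
    intro j h m hm
    obtain ⟨m', hm'⟩ := (hY j).exists_isCoarseCenter (σ j h) (τ j h) m
    exact ⟨m', hm'.1, (S.dist_incl_le _ _ _).trans ((hY j).center_unique
      ((isCoarseCenter_self hm).mono (le_max_left C δ)) (hm'.mono (le_max_right C δ)))⟩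
  have hpos : ∀ (k : ℕ) h m, gromovProduct m (σ (k : ℤ) h) (τ k h) ≤ δ →
      ∃ m₀, gromovProduct m₀ (σ 0 h₀) (τ 0 h₀) ≤ δ ∧
        dist (S.incl k m) (S.incl 0 m₀) ≤ (K + (6 * max C δ + 2 * δ)) * k := by
    intro k
    induction k with
    | zero => exact fun h m hm => ⟨m, hm, by simp⟩
    | succ k ih =>
      -- Restated, so that the index has the form in which levels are adjacent.
      suffices hsucc : ∀ h m, gromovProduct m (σ ((k : ℤ) + 1) h) (τ ((k : ℤ) + 1) h) ≤ δ →
          ∃ m₀, gromovProduct m₀ (σ 0 h₀) (τ 0 h₀) ≤ δ ∧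
            dist (S.incl ((k : ℤ) + 1) m) (S.incl 0 m₀) ≤
              (K + (6 * max C δ + 2 * δ)) * (k + 1 : ℕ) from hsucc
      intro h m hm
      have h' := S.nonempty_natCast h₀ k
      have hR := S.adj_correspondence k h'
      obtain ⟨m₁, hm₁⟩ := hR.2.1 m
      obtain ⟨m₂, hm₂, hd⟩ := hproj k h' m₁ (hC _ _ (hY (k + 1)) (hY k) _ hR.swap _ _ _ _ _ _
        (hσ k h' h) (hτ k h' h) hm₁ hm)
      obtain ⟨m₀, hm₀, hd₀⟩ := ih h' m₂ hm₂
      refine ⟨m₀, hm₀, ?_⟩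
      have h1 := S.dist_le_of_adj _ _ _ hm₁
      have h2 := dist_triangle4 (S.incl (k + 1) m) (S.incl k m₁) (S.incl k m₂) (S.incl 0 m₀)
      rw [dist_comm (S.incl (k + 1) m) (S.incl k m₁)] at h2
      push_cast
      linarith
  have hneg : ∀ (k : ℕ) (j : ℤ), j = -(k : ℤ) → ∀ h m, gromovProduct m (σ j h) (τ j h) ≤ δ →
      ∃ m₀, gromovProduct m₀ (σ 0 h₀) (τ 0 h₀) ≤ δ ∧
        dist (S.incl j m) (S.incl 0 m₀) ≤ (K + (6 * max C δ + 2 * δ)) * k := by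
    intro k
    induction k with
    | zero =>
      rintro j hj
      obtain rfl : j = 0 := by simpa using hj
      exact fun h m hm => ⟨m, hm, by simp⟩
    | succ k ih =>
      intro j hj h m hm
      have h' := S.nonempty_succ h
      have hR := S.adj_correspondence j h
      obtain ⟨m₁, hm₁⟩ := hR.1 m
      obtain ⟨m₂, hm₂, hd⟩ := hproj (j + 1) h' m₁ (hC _ _ (hY j) (hY (j + 1)) _ hR _ _ _ _ _ _
        (hσ j h h') (hτ j h h') hm₁ hm)
      obtain ⟨m₀, hm₀, hd₀⟩ := ih (j + 1) (by push_cast at hj; omega) h' m₂ hm₂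
      refine ⟨m₀, hm₀, ?_⟩
      have h1 := S.dist_le_of_adj _ _ _ hm₁
      have h2 := dist_triangle4 (S.incl j m) (S.incl (j + 1) m₁) (S.incl (j + 1) m₂) (S.incl 0 m₀)
      push_cast
      linarith
  intro j h m hm
  rcases Int.natAbs_eq j with hj | hj
  · generalize j.natAbs = k at hj
    subst hj
    simpa using hpos k h m hm
  · have := hneg _ j hj h m hm
    rwa [← Int.cast_natCast, Int.natCast_natAbs, Int.cast_abs] at this

/-- In a hyperbolic coarse stack with hyperbolic levels, geodesics of the level `Y 0` that are far
away from a point `p` in `Y 0` have endpoints whose geodesics in `X` are far away from `p`. -/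
theorem exists_le_gromovProduct_incl {δ : ℝ} (hX : IsHyperbolicSpace δ X)
    (hY : ∀ j, IsHyperbolicSpace δ (Y j)) (p : Y 0) (M : ℝ) :
    ∃ N : ℝ, ∀ a b : Y 0, N ≤ gromovProduct p a b →
      M ≤ gromovProduct (S.incl 0 p) (S.incl 0 a) (S.incl 0 b) := by
  have hδ : 0 ≤ δ := by
    have := hX.2 (S.incl 0 p) (S.incl 0 p) (S.incl 0 p) (S.incl 0 p)
    simp only [gromovProduct_self_left, min_self] at this
    linarith
  have hK : 0 ≤ K := dist_nonneg.trans (S.dist_floor_le (S.incl 0 p) (S.incl 0 p)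
    (by rw [dist_self]; norm_num) 0 p p (S.floor_incl 0 p) (S.floor_incl 0 p))
  obtain ⟨L, hL⟩ := S.exists_ladder_retraction hδ hK hX.1 hY
  obtain ⟨ρ, hρ⟩ := exists_dist_retraction_le δ L
  obtain ⟨C, hC⟩ := S.exists_ladder_path hY ⟨p⟩
  set D : ℝ := M + 2 * δ + ρ with hD
  obtain ⟨H, hH⟩ := S.exists_dist_le_of_dist_incl_le hX.1 (D + max C 0 * D)
  refine ⟨H + δ + 1, fun a b hab => ?_⟩
  by_contra! hlt
  obtain ⟨σ, hσ, hσa⟩ := S.exists_section a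
  obtain ⟨τ, hτ, hτb⟩ := S.exists_section b
  obtain ⟨π, hπ, hπm, hπL⟩ := hL σ τ hσ hτ
  obtain ⟨c, hc⟩ := hX.1 (S.incl 0 a) (S.incl 0 b)
  obtain ⟨t, ht, -, htp⟩ := hX.exists_center hc (S.incl 0 p)
  obtain ⟨z, hz⟩ := hρ X hX π hπ (fun x => by
    obtain ⟨j, h, m, e, hm⟩ := hπm x
    rw [e]
    exact hπL j h m hm) _ _ c hc
    (hπL 0 ⟨p⟩ a (by rw [hσa, gromovProduct_self_left]; exact hδ))
    (hπL 0 ⟨p⟩ b (by rw [hτb, gromovProduct_self_right]; exact hδ)) t ht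
  obtain ⟨j, h, m, e, hm⟩ := hπm z
  rw [e] at hz
  have hmp : dist (S.incl j m) (S.incl 0 p) ≤ D := by
    have := dist_triangle_left (S.incl j m) (S.incl 0 p) (c t)
    linarith
  obtain ⟨m₀, hm₀, hd⟩ := hC σ τ hσ hτ j h m hm
  have h1 : C * |(j : ℝ)| ≤ max C 0 * D :=
    mul_le_mul (le_max_left _ _) ((S.abs_le_dist j m p).trans hmp) (abs_nonneg _) (le_max_right _ _)
  have h2 := hH m₀ p (by linarith [dist_triangle_left (S.incl 0 m₀) (S.incl 0 p) (S.incl j m)])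
  rw [hσa, hτb] at hm₀
  have h3 := gromovProduct_le_add p m₀ a b a b
  rw [dist_self, dist_self, dist_comm] at h3
  linarith

end CoarseStack

end Stack

/-! ### The metric of a tree of spaces -/

section Curves

lemma exists_isLeast_isGreatest_of_continuousOn {f : ℝ → ℝ} {s t α : ℝ}
    (hf : ContinuousOn f (Icc s t)) (h : ∃ u ∈ Icc s t, f u = α) :
    (∃ u, IsLeast (Icc s t ∩ f ⁻¹' {α}) u) ∧ ∃ u, IsGreatest (Icc s t ∩ f ⁻¹' {α}) u := by
  have hc : IsCompact (Icc s t ∩ f ⁻¹' {α}) :=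
    isCompact_Icc.of_isClosed_subset
      (hf.preimage_isClosed_of_isClosed isClosed_Icc isClosed_singleton) inter_subset_left
  obtain ⟨u, hu, hu'⟩ := h
  exact ⟨hc.exists_isLeast ⟨u, hu, hu'⟩, hc.exists_isGreatest ⟨u, hu, hu'⟩⟩

lemma exists_crossing {f : ℝ → ℝ} {s t α β : ℝ} (hst : s ≤ t) (hf : ContinuousOn f (Icc s t))
    (hα : f s ≤ α) (hαβ : α ≤ β) (hβ : β ≤ f t) :
    ∃ s' t', s ≤ s' ∧ s' ≤ t' ∧ t' ≤ t ∧ f s' = α ∧ f t' = β ∧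
      ∀ u ∈ Icc s' t', f u ∈ Icc α β := by
  obtain ⟨u, hu, hu'⟩ := intermediate_value_Icc hst hf ⟨hα, hαβ.trans hβ⟩
  obtain ⟨s', ⟨hs', hs'α⟩, hs'max⟩ :=
    (exists_isLeast_isGreatest_of_continuousOn hf ⟨u, hu, hu'⟩).2
  have hs'α : f s' = α := hs'α
  have hf' : ContinuousOn f (Icc s' t) := hf.mono (Icc_subset_Icc_left hs'.1)
  have hge : ∀ u ∈ Icc s' t, α ≤ f u := by
    intro u hu
    by_contra! hlt
    obtain ⟨v, hv, hv'⟩ := intermediate_value_Icc hu.2 (hf'.mono (Icc_subset_Icc_left hu.1))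
      ⟨hlt.le, hαβ.trans hβ⟩
    have : v ≤ s' := hs'max ⟨⟨by linarith [hs'.1, hu.1, hv.1], hv.2⟩, hv'⟩
    obtain rfl : u = s' := le_antisymm (by linarith [hv.1]) hu.1
    linarith
  obtain ⟨w, hw, hw'⟩ := intermediate_value_Icc hs'.2 hf' ⟨hs'α.le.trans hαβ, hβ⟩
  obtain ⟨t', ⟨ht', ht'β⟩, ht'min⟩ :=
    (exists_isLeast_isGreatest_of_continuousOn hf' ⟨w, hw, hw'⟩).1
  have ht'β : f t' = β := ht'β
  refine ⟨s', t', hs'.1, ht'.1, ht'.2, hs'α, ht'β, fun u hu => ⟨hge u ⟨hu.1, hu.2.trans ht'.2⟩, ?_⟩⟩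
  by_contra! hlt
  have hut : u ≤ t := hu.2.trans ht'.2
  obtain ⟨v, hv, hv'⟩ := intermediate_value_Icc hu.1 (hf'.mono (Icc_subset_Icc_right hut))
    ⟨hs'α.le.trans hαβ, hlt.le⟩
  have : t' ≤ v := ht'min ⟨⟨hv.1, hv.2.trans hut⟩, hv'⟩
  obtain rfl : u = t' := le_antisymm hu.2 (by linarith [hv.2])
  linarith

variable {X : Type*} [MetricSpace X]

lemma edist_le_inducedPathEDist (S : Set X) (x y : X) : edist x y ≤ inducedPathEDist S x y :=
  le_iInf₂ fun γ _ => by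
    simpa using eVariationOn.edist_le γ (mem_univ (0 : unitInterval)) (mem_univ 1)

/-- A `1`-Lipschitz curve in `S` bounds the path metric of `S`. -/
lemma inducedPathEDist_le_of_lipschitz {S : Set X} {c : ℝ → X} {a b : ℝ} (hab : a ≤ b)
    (hc : ∀ s ∈ Icc a b, ∀ t ∈ Icc a b, dist (c s) (c t) ≤ |s - t|) (hS : ∀ t ∈ Icc a b, c t ∈ S) :
    inducedPathEDist S (c a) (c b) ≤ ENNReal.ofReal (b - a) := by
  have hLip : LipschitzOnWith 1 c (Icc a b) :=
    LipschitzOnWith.of_dist_le_mul fun s hs t ht => by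
      simpa [Real.dist_eq] using hc s hs t ht
  let f : unitInterval → ℝ := fun u => a + u * (b - a)
  have hf : Continuous f := by fun_prop
  have hba : 0 ≤ b - a := by linarith
  have hmaps : ∀ u, f u ∈ Icc a b := fun u => by
    have h1 := mul_nonneg u.2.1 hba
    have h2 := mul_le_mul_of_nonneg_right u.2.2 hba
    constructor <;> simp only [f] <;> linarith
  have hmono : Monotone f := fun u v huv => by
    have : (u : ℝ) * (b - a) ≤ v * (b - a) := mul_le_mul_of_nonneg_right huv hba
    simp only [f]; linarith
  let γ : Path (c a) (c b) :=
    { toFun := fun u => c (f u)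
      continuous_toFun := hLip.continuousOn.comp_continuous hf hmaps
      source' := by simp [f]
      target' := by simp [f] }
  refine (iInf₂_le γ fun u => hS _ (hmaps u)).trans ?_
  have h1 : eVariationOn (c ∘ f) univ ≤ (1 : NNReal) * eVariationOn f univ :=
    hLip.comp_eVariationOn_le fun u _ => hmaps u
  have h2 := (hmono.monotoneOn univ).eVariationOn_eq (mem_univ 0) (mem_univ 1)
  have h3 : univ ∩ Icc (0 : unitInterval) 1 = univ := by
    rw [univ_inter]
    exact eq_univ_of_forall fun u => ⟨u.2.1, u.2.2⟩
  rw [h3] at h2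
  have h4 : f 1 - f 0 = b - a := by simp [f]
  rw [h4] at h2
  simp only [ENNReal.coe_one, one_mul] at h1
  exact h1.trans h2.le

lemma inducedPathEDist_self {S : Set X} {x : X} (hx : x ∈ S) : inducedPathEDist S x x = 0 := by
  have := inducedPathEDist_le_of_lipschitz (S := S) (c := fun _ => x) (le_refl (0 : ℝ))
    (fun s _ t _ => by simp) (fun _ _ => hx)
  simpa using this

end Curves

namespace TreeOfSpaces

variable {T : Set ℝ} {X : Type*} [MetricSpace X] {Y E : ℤ → Type*} [∀ j, MetricSpace (Y j)]
  [∀ j, MetricSpace (E j)] (𝒳 : TreeOfSpaces T X Y E)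

lemma proj_incl (j : ℤ) (y : Y j) : 𝒳.proj (𝒳.incl j y) = j := by
  have : 𝒳.incl j y ∈ range (𝒳.incl j) := mem_range_self y
  rwa [𝒳.range_incl] at this

lemma dist_incl_le (j : ℤ) (a b : Y j) : dist (𝒳.incl j a) (𝒳.incl j b) ≤ dist a b := by
  have h := edist_le_inducedPathEDist {x | 𝒳.proj x = j} (𝒳.incl j a) (𝒳.incl j b)
  rw [← 𝒳.edist_vertex, edist_dist, edist_dist] at h
  exact (ENNReal.ofReal_le_ofReal_iff dist_nonneg).1 h

lemma dist_le_of_inducedPathEDist_le {j : ℤ} {a b : Y j} {r : ℝ} (hr : 0 ≤ r)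
    (h : inducedPathEDist {x | 𝒳.proj x = j} (𝒳.incl j a) (𝒳.incl j b) ≤ ENNReal.ofReal r) :
    dist a b ≤ r := by
  rw [← 𝒳.edist_vertex, edist_dist] at h
  exact (ENNReal.ofReal_le_ofReal_iff hr).1 h

lemma incl_injective (j : ℤ) : Function.Injective (𝒳.incl j) := by
  intro a b hab
  have h := inducedPathEDist_self (S := {x | 𝒳.proj x = j}) (𝒳.proj_incl j a)
  nth_rewrite 2 [hab] at h
  rwa [← 𝒳.edist_vertex, edist_eq_zero] at h

/-- The strips are `1`-Lipschitz up to and including their ends, by continuity. -/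
lemma dist_strip_le (j : ℤ) (e e' : E j) (s t : unitInterval) :
    dist (𝒳.strip j (e, s)) (𝒳.strip j (e', t)) ≤
      Real.sqrt (dist e e' ^ 2 + ((s : ℝ) - t) ^ 2) := by
  have hcl : IsClosed {q : unitInterval × unitInterval |
      dist (𝒳.strip j (e, q.1)) (𝒳.strip j (e', q.2)) ≤
        Real.sqrt (dist e e' ^ 2 + ((q.1 : ℝ) - q.2) ^ 2)} := by
    have := 𝒳.continuous_strip j
    exact isClosed_le (by fun_prop) (by fun_prop)
  have hd : Dense (Ioo (0 : unitInterval) 1) := by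
    rw [dense_iff_closure_eq, closure_Ioo (by simp)]
    exact eq_univ_of_forall fun u => ⟨u.2.1, u.2.2⟩
  have hsub : Ioo (0 : unitInterval) 1 ×ˢ Ioo (0 : unitInterval) 1 ⊆
      {q : unitInterval × unitInterval |
      dist (𝒳.strip j (e, q.1)) (𝒳.strip j (e', q.2)) ≤
        Real.sqrt (dist e e' ^ 2 + ((q.1 : ℝ) - q.2) ^ 2)} := by
    rintro ⟨u, v⟩ ⟨hu, hv⟩
    have h := edist_le_inducedPathEDist {x | 𝒳.proj x ∈ Ioo (j : ℝ) (j + 1)}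
      (𝒳.strip j (e, u)) (𝒳.strip j (e', v))
    rw [𝒳.strip_isometry j e e' u v hu hv, edist_dist] at h
    exact (ENNReal.ofReal_le_ofReal_iff (Real.sqrt_nonneg _)).1 h
  have := closure_minimal hsub hcl
  rw [(hd.prod hd).closure_eq] at this
  exact this (mem_univ (s, t))

lemma dist_strip_left_le (j : ℤ) (e : E j) (s t : unitInterval) :
    dist (𝒳.strip j (e, s)) (𝒳.strip j (e, t)) ≤ |(s : ℝ) - t| := by
  have := 𝒳.dist_strip_le j e e s t
  rwa [dist_self, zero_pow two_ne_zero, zero_add, Real.sqrt_sq_eq_abs] at this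

lemma dist_strip_right_le (j : ℤ) (e e' : E j) (s : unitInterval) :
    dist (𝒳.strip j (e, s)) (𝒳.strip j (e', s)) ≤ dist e e' := by
  have := 𝒳.dist_strip_le j e e' s s
  rwa [sub_self, zero_pow two_ne_zero, add_zero, Real.sqrt_sq dist_nonneg] at this

lemma strip_mem {j : ℤ} {e : E j} {t : unitInterval} (ht : (t : ℝ) ∈ Ioo (0 : ℝ) 1) :
    𝒳.proj (𝒳.strip j (e, t)) ∈ Ioo (j : ℝ) (j + 1) := by
  rw [𝒳.proj_strip]
  exact ⟨by linarith [ht.1], by linarith [ht.2]⟩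

lemma exists_strip {j : ℤ} {x : X} (hx : 𝒳.proj x ∈ Ioo (j : ℝ) (j + 1)) :
    ∃ (e : E j) (t : unitInterval), (t : ℝ) ∈ Ioo (0 : ℝ) 1 ∧ x = 𝒳.strip j (e, t) := by
  obtain ⟨⟨e, t⟩, rfl⟩ := 𝒳.strip_surj j x hx
  rw [𝒳.proj_strip] at hx
  exact ⟨e, t, ⟨by linarith [hx.1], by linarith [hx.2]⟩, rfl⟩

lemma strip_injective {j : ℤ} {e e' : E j} {s t : unitInterval} (hs : (s : ℝ) ∈ Ioo (0 : ℝ) 1)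
    (ht : (t : ℝ) ∈ Ioo (0 : ℝ) 1) (h : 𝒳.strip j (e, s) = 𝒳.strip j (e', t)) : e = e' := by
  have h1 := 𝒳.strip_isometry j e e' s t hs ht
  rw [← h, inducedPathEDist_self (S := {x | 𝒳.proj x ∈ Ioo (j : ℝ) (j + 1)}) (𝒳.strip_mem hs),
    eq_comm, ENNReal.ofReal_eq_zero] at h1
  have h2 := Real.le_sqrt_of_sq_le (le_add_of_nonneg_right
    (sq_nonneg ((s : ℝ) - t)) : dist e e' ^ 2 ≤ dist e e' ^ 2 + ((s : ℝ) - t) ^ 2)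
  exact dist_le_zero.1 (h2.trans h1)

/-- Along a geodesic of `X` that stays in an open strip, both coordinates are `1`-Lipschitz. -/
lemma geodesic_strip {c : ℝ → X} {x y : X} (hc : IsGeodesicSegment c x y) {s t : ℝ}
    (hs : 0 ≤ s) (hst : s ≤ t) (ht : t ≤ dist x y) {j : ℤ}
    (h : ∀ u ∈ Icc s t, 𝒳.proj (c u) ∈ Ioo (j : ℝ) (j + 1)) :
    ∃ (e e' : E j) (s' t' : unitInterval), (s' : ℝ) ∈ Ioo (0 : ℝ) 1 ∧ (t' : ℝ) ∈ Ioo (0 : ℝ) 1 ∧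
      c s = 𝒳.strip j (e, s') ∧ c t = 𝒳.strip j (e', t') ∧ dist e e' ≤ t - s ∧
      |𝒳.proj (c s) - 𝒳.proj (c t)| ≤ t - s := by
  obtain ⟨e, s', hs', hcs⟩ := 𝒳.exists_strip (h s ⟨le_rfl, hst⟩)
  obtain ⟨e', t', ht', hct⟩ := 𝒳.exists_strip (h t ⟨hst, le_rfl⟩)
  have hsub : ∀ u ∈ Icc s t, u ∈ Icc 0 (dist x y) := fun u hu =>
    ⟨hs.trans hu.1, hu.2.trans ht⟩
  have h1 := inducedPathEDist_le_of_lipschitz (S := {x | 𝒳.proj x ∈ Ioo (j : ℝ) (j + 1)}) hst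
    (fun u hu v hv => (hc.2.2 u (hsub u hu) v (hsub v hv)).le) h
  rw [hcs, hct, 𝒳.strip_isometry j e e' s' t' hs' ht',
    ENNReal.ofReal_le_ofReal_iff (by linarith)] at h1
  refine ⟨e, e', s', t', hs', ht', hcs, hct, le_trans ?_ h1, le_trans ?_ h1⟩
  · exact Real.le_sqrt_of_sq_le (le_add_of_nonneg_right (sq_nonneg _))
  · rw [hcs, hct, 𝒳.proj_strip, 𝒳.proj_strip, add_sub_add_left_eq_sub]
    exact Real.abs_le_sqrt (le_add_of_nonneg_left (sq_nonneg _))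

lemma continuousOn_proj_geodesic {c : ℝ → X} {x y : X} (hc : IsGeodesicSegment c x y) :
    ContinuousOn (fun u => 𝒳.proj (c u)) (Icc 0 (dist x y)) :=
  𝒳.continuous_proj.comp_continuousOn hc.continuousOn

lemma proj_sub_le_of_mem_edge {c : ℝ → X} {x y : X} (hc : IsGeodesicSegment c x y) {s t : ℝ}
    (hs : 0 ≤ s) (hst : s ≤ t) (ht : t ≤ dist x y) {j : ℤ} (hj : (j : ℝ) ≤ 𝒳.proj (c s))
    (hj' : 𝒳.proj (c t) ≤ j + 1) : 𝒳.proj (c t) - 𝒳.proj (c s) ≤ t - s := by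
  refine le_of_forall_pos_le_add fun η hη => ?_
  by_contra! hlt
  have hf : ContinuousOn (fun u => 𝒳.proj (c u)) (Icc s t) :=
    (𝒳.continuousOn_proj_geodesic hc).mono (Icc_subset_Icc hs ht)
  obtain ⟨s', t', h1, h2, h3, h4, h5, h6⟩ := exists_crossing hst hf
    (α := 𝒳.proj (c s) + η / 2) (β := 𝒳.proj (c t) - η / 2) (by linarith) (by linarith)
    (by linarith)
  obtain ⟨-, -, -, -, -, -, -, -, -, h7⟩ := 𝒳.geodesic_strip hc (hs.trans h1) h2 (h3.trans ht)
    (j := j) (fun u hu => ⟨by linarith [(h6 u hu).1], by linarith [(h6 u hu).2]⟩)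
  rw [abs_sub_comm] at h7
  have h8 := (le_abs_self _).trans h7
  linarith

lemma proj_sub_le {c : ℝ → X} {x y : X} (hc : IsGeodesicSegment c x y) (n : ℕ) :
    ∀ {s t : ℝ}, 0 ≤ s → s ≤ t → t ≤ dist x y → 𝒳.proj (c t) ≤ ⌊𝒳.proj (c s)⌋ + 1 + n →
      𝒳.proj (c t) - 𝒳.proj (c s) ≤ t - s := by
  induction n with
  | zero =>
    intro s t hs hst ht h
    exact 𝒳.proj_sub_le_of_mem_edge hc hs hst ht (Int.floor_le _) (by simpa using h)
  | succ n ih =>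
    intro s t hs hst ht h
    by_cases hle : 𝒳.proj (c t) ≤ ⌊𝒳.proj (c s)⌋ + 1
    · exact 𝒳.proj_sub_le_of_mem_edge hc hs hst ht (Int.floor_le _) hle
    · push Not at hle
      have hf : ContinuousOn (fun u => 𝒳.proj (c u)) (Icc s t) :=
        (𝒳.continuousOn_proj_geodesic hc).mono (Icc_subset_Icc hs ht)
      obtain ⟨u, hu, hu'⟩ := intermediate_value_Icc hst hf
        ⟨(Int.lt_floor_add_one _).le, hle.le⟩
      simp only at hu'
      have h1 := 𝒳.proj_sub_le_of_mem_edge hc hs hu.1 (hu.2.trans ht) (Int.floor_le _) hu'.le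
      have hfl : ⌊𝒳.proj (c u)⌋ = ⌊𝒳.proj (c s)⌋ + 1 := by
        rw [hu']
        exact_mod_cast Int.floor_intCast (⌊𝒳.proj (c s)⌋ + 1)
      have h2 := ih (hs.trans hu.1) hu.2 ht (by rw [hfl]; push_cast at h ⊢; linarith)
      linarith

/-- The projection to the tree is `1`-Lipschitz. -/
lemma abs_proj_sub_le (hX : IsGeodesicSpace X) (x y : X) :
    |𝒳.proj x - 𝒳.proj y| ≤ dist x y := by
  have key : ∀ x y, 𝒳.proj y - 𝒳.proj x ≤ dist x y := by
    intro x y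
    obtain ⟨c, hc⟩ := hX x y
    have hc' : IsGeodesicSegment c x y := hc
    have h := 𝒳.proj_sub_le hc' ⌈𝒳.proj y - (⌊𝒳.proj x⌋ + 1)⌉₊ le_rfl dist_nonneg le_rfl (by
      rw [hc.1, hc.2.1]
      linarith [Nat.le_ceil (𝒳.proj y - (⌊𝒳.proj x⌋ + 1))])
    rw [hc.1, hc.2.1] at h
    linarith
  have h1 := key x y
  have h2 := key y x
  rw [dist_comm] at h2
  exact abs_le.2 ⟨by linarith, by linarith⟩

/-- `𝒳.Collapse j x y` says that `y` is the image of the point `x`, which lies over the open star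
`(j - 1, j + 1)` of the vertex `j`, under the map that collapses the two strips adjacent to the
vertex space at `j` to that vertex space. It is a relation in `X`, so that the index of the strip
that ends at `j` need not be of the form `j - 1` definitionally. -/
def Collapse (j : ℤ) (x y : X) : Prop :=
  (𝒳.proj x = j ∧ y = x) ∨
  (∃ (e : E j) (t : unitInterval), (t : ℝ) ∈ Ioo (0 : ℝ) 1 ∧ x = 𝒳.strip j (e, t) ∧ y = 𝒳.strip j (e, 0)) ∨
  ∃ (i : ℤ) (e : E i) (t : unitInterval), i + 1 = j ∧ (t : ℝ) ∈ Ioo (0 : ℝ) 1 ∧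
    x = 𝒳.strip i (e, t) ∧ y = 𝒳.strip i (e, 1)

lemma collapse_incl (j : ℤ) (y : Y j) : 𝒳.Collapse j (𝒳.incl j y) (𝒳.incl j y) :=
  Or.inl ⟨𝒳.proj_incl j y, rfl⟩

variable {𝒳}

lemma Collapse.unique {j : ℤ} {x y y' : X} (h : 𝒳.Collapse j x y) (h' : 𝒳.Collapse j x y') :
    y = y' := by
  rcases h with ⟨h1, rfl⟩ | ⟨e, t, ht, rfl, rfl⟩ | ⟨i, e, t, rfl, ht, rfl, rfl⟩
  · rcases h' with ⟨h1', rfl⟩ | ⟨e', t', ht', rfl, rfl⟩ | ⟨i, e', t', rfl, ht', rfl, rfl⟩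
    · rfl
    · have := (𝒳.strip_mem (e := e') ht').1
      linarith
    · have := (𝒳.strip_mem (e := e') ht').2
      push_cast at h1
      linarith
  · have h2 := (𝒳.strip_mem (e := e) ht).1
    rcases h' with ⟨h1', rfl⟩ | ⟨e', t', ht', he, rfl⟩ | ⟨i, e', t', rfl, ht', he, rfl⟩
    · linarith
    · rw [𝒳.strip_injective ht ht' he]
    · have := (𝒳.strip_mem (e := e') ht').2
      rw [← he] at this
      push_cast at h2
      linarith
  · have h2 := (𝒳.strip_mem (e := e) ht).2
    rcases h' with ⟨h1', rfl⟩ | ⟨e', t', ht', he, rfl⟩ | ⟨i', e', t', hi, ht', he, rfl⟩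
    · push_cast at h1'
      linarith
    · have := (𝒳.strip_mem (e := e') ht').1
      rw [← he] at this
      push_cast at this
      linarith
    · obtain rfl : i' = i := by omega
      rw [𝒳.strip_injective ht ht' he]

lemma Collapse.proj_eq {j : ℤ} {x y : X} (h : 𝒳.Collapse j x y) : 𝒳.proj y = j := by
  rcases h with ⟨h1, rfl⟩ | ⟨e, t, ht, rfl, rfl⟩ | ⟨i, e, t, rfl, ht, rfl, rfl⟩
  · exact h1
  · simp [𝒳.proj_strip]
  · simp [𝒳.proj_strip]

lemma Collapse.dist_le {j : ℤ} {x y : X} (h : 𝒳.Collapse j x y) :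
    dist x y ≤ |𝒳.proj x - j| := by
  rcases h with ⟨h1, rfl⟩ | ⟨e, t, ht, rfl, rfl⟩ | ⟨i, e, t, rfl, ht, rfl, rfl⟩
  · simp
  · simpa [𝒳.proj_strip] using 𝒳.dist_strip_left_le j e t 0
  · simpa [𝒳.proj_strip] using 𝒳.dist_strip_left_le i e t 1

variable (𝒳)

lemma exists_collapse {j : ℤ} {x : X} (hx : |𝒳.proj x - j| < 1) : ∃ y, 𝒳.Collapse j x y := by
  rw [abs_lt] at hx
  rcases lt_trichotomy (𝒳.proj x) j with h | h | h
  · obtain ⟨e, t, ht, rfl⟩ := 𝒳.exists_strip (j := j - 1) (x := x)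
      ⟨by push_cast; linarith, by push_cast; linarith⟩
    exact ⟨_, Or.inr (Or.inr ⟨_, e, t, by omega, ht, rfl, rfl⟩)⟩
  · exact ⟨x, Or.inl ⟨h, rfl⟩⟩
  · obtain ⟨e, t, ht, rfl⟩ := 𝒳.exists_strip (j := j) (x := x) ⟨h, by linarith⟩
    exact ⟨_, Or.inr (Or.inl ⟨e, t, ht, rfl, rfl⟩)⟩

lemma dist_collapse_le_of_avoids {c : ℝ → X} {x y : X} (hc : IsGeodesicSegment c x y) {j : ℤ}
    (hj : ∀ u ∈ Icc 0 (dist x y), |𝒳.proj (c u) - j| < 1) {s t : ℝ}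
    (hs : s ∈ Icc 0 (dist x y)) (ht : t ∈ Icc 0 (dist x y))
    (h : ∀ u ∈ uIcc s t, 𝒳.proj (c u) ≠ j) {p q : X} (hp : 𝒳.Collapse j (c s) p)
    (hq : 𝒳.Collapse j (c t) q) : dist p q ≤ |s - t| := by
  wlog hst : s ≤ t generalizing s t p q
  · rw [dist_comm, abs_sub_comm]
    exact this ht hs (by rwa [uIcc_comm]) hq hp (le_of_not_ge hst)
  rw [uIcc_of_le hst] at h
  rw [abs_sub_comm, abs_of_nonneg (by linarith)]
  have hsub : Icc s t ⊆ Icc 0 (dist x y) := Icc_subset_Icc hs.1 ht.2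
  have hf : ContinuousOn (fun u => 𝒳.proj (c u)) (Icc s t) :=
    (𝒳.continuousOn_proj_geodesic hc).mono hsub
  -- The geodesic stays on one side of the vertex, hence in one of the two strips.
  rcases lt_or_gt_of_ne (h s ⟨le_rfl, hst⟩) with hlt | hgt
  · have hall : ∀ u ∈ Icc s t, 𝒳.proj (c u) ∈ Ioo ((j - 1 : ℤ) : ℝ) ((j - 1 : ℤ) + 1) := by
      intro u hu
      have h1 := abs_lt.1 (hj u (hsub hu))
      push_cast
      refine ⟨by linarith, ?_⟩
      by_contra! hge
      obtain ⟨v, hv, hv'⟩ := intermediate_value_Icc hu.1 (hf.mono (Icc_subset_Icc_right hu.2))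
        ⟨hlt.le, by simpa using hge⟩
      exact h v ⟨hv.1, hv.2.trans hu.2⟩ hv'
    obtain ⟨e, e', s', t', hs', ht', hcs, hct, hd, -⟩ := 𝒳.geodesic_strip hc hs.1 hst ht.2 hall
    rw [hp.unique (Or.inr (Or.inr ⟨_, e, s', by omega, hs', hcs, rfl⟩)),
      hq.unique (Or.inr (Or.inr ⟨_, e', t', by omega, ht', hct, rfl⟩))]
    exact (𝒳.dist_strip_right_le _ _ _ _).trans hd
  · have hall : ∀ u ∈ Icc s t, 𝒳.proj (c u) ∈ Ioo (j : ℝ) (j + 1) := by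
      intro u hu
      have h1 := abs_lt.1 (hj u (hsub hu))
      refine ⟨?_, by linarith⟩
      by_contra! hle
      obtain ⟨v, hv, hv'⟩ := intermediate_value_Icc' hu.1 (hf.mono (Icc_subset_Icc_right hu.2))
        ⟨hle, hgt.le⟩
      exact h v ⟨hv.1, hv.2.trans hu.2⟩ hv'
    obtain ⟨e, e', s', t', hs', ht', hcs, hct, hd, -⟩ := 𝒳.geodesic_strip hc hs.1 hst ht.2 hall
    rw [hp.unique (Or.inr (Or.inl ⟨e, s', hs', hcs, rfl⟩)),
      hq.unique (Or.inr (Or.inl ⟨e', t', ht', hct, rfl⟩))]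
    exact (𝒳.dist_strip_right_le _ _ _ _).trans hd

lemma dist_collapse_le_of_first (hX : IsGeodesicSpace X) {c : ℝ → X} {x y : X}
    (hc : IsGeodesicSegment c x y) {j : ℤ}
    (hj : ∀ u ∈ Icc 0 (dist x y), |𝒳.proj (c u) - j| < 1) {s t : ℝ}
    (hs : s ∈ Icc 0 (dist x y)) (ht : t ∈ Icc 0 (dist x y)) (htj : 𝒳.proj (c t) = j)
    (h : ∀ u ∈ uIcc s t, u ≠ t → 𝒳.proj (c u) ≠ j) {p : X} (hp : 𝒳.Collapse j (c s) p) :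
    dist p (c t) ≤ |s - t| := by
  by_cases hst : s = t
  · subst hst
    rw [hp.unique (Or.inl ⟨htj, rfl⟩)]
    simp
  have hst' : 0 < |s - t| := abs_pos.2 (sub_ne_zero.2 hst)
  refine le_of_forall_pos_le_add fun η hη => ?_
  -- Compare with the point `u` of the segment from `s` to `t` at distance `θ * |s - t|` from `t`.
  obtain ⟨θ, hθ0, hθ1, hθ⟩ : ∃ θ : ℝ, 0 < θ ∧ θ ≤ 1 ∧ θ * |s - t| ≤ η / 2 := by
    refine ⟨min 1 (η / 2 / |s - t|), by positivity, min_le_left _ _, ?_⟩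
    rw [← le_div_iff₀ hst']
    exact min_le_right _ _
  set u : ℝ := t + θ * (s - t) with hu
  have hut : u - t = θ * (s - t) := by rw [hu]; ring
  have hsu : s - u = (1 - θ) * (s - t) := by rw [hu]; ring
  have hut' : |u - t| = θ * |s - t| := by rw [hut, abs_mul, abs_of_pos hθ0]
  have hsu' : |s - u| = (1 - θ) * |s - t| := by rw [hsu, abs_mul, abs_of_nonneg (by linarith)]
  have hmem : u ∈ uIcc s t := by
    rw [mem_uIcc]
    rcases le_total s t with h' | h'
    · left
      constructor <;> nlinarith
    · right
      constructor <;> nlinarith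
  have hune : ∀ v ∈ uIcc s u, v ≠ t := by
    rintro v hv rfl
    have h1 := abs_sub_left_of_mem_uIcc hv
    rw [abs_sub_comm u, hsu', abs_sub_comm] at h1
    nlinarith
  have huI : u ∈ Icc 0 (dist x y) := (ordConnected_Icc.uIcc_subset hs ht) hmem
  obtain ⟨q, hq⟩ := 𝒳.exists_collapse (hj u huI)
  have h1 := 𝒳.dist_collapse_le_of_avoids hc hj hs huI
    (fun v hv => h v (uIcc_subset_uIcc_left hmem hv) (hune v hv)) hp hq
  have h2 := hq.dist_le
  have h3 := 𝒳.abs_proj_sub_le hX (c u) (c t)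
  have h4 := hc.2.2 u huI t ht
  rw [htj] at h3
  rw [dist_comm] at h2
  linarith [dist_triangle4 p q (c u) (c t)]

/-- Collapsing strips does not increase distances along a geodesic of `X`. Between the first and
the last visit to the vertex space there is nothing to prove, even though the geodesic may leave the
vertex space infinitely often, because distances along a geodesic are distances in `X`. -/
lemma dist_collapse_le (hX : IsGeodesicSpace X) {c : ℝ → X} {x y : X}
    (hc : IsGeodesicSegment c x y) {j : ℤ}
    (hj : ∀ u ∈ Icc 0 (dist x y), |𝒳.proj (c u) - j| < 1) {s t : ℝ}
    (hs : s ∈ Icc 0 (dist x y)) (ht : t ∈ Icc 0 (dist x y)) {p q : X}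
    (hp : 𝒳.Collapse j (c s) p) (hq : 𝒳.Collapse j (c t) q) : dist p q ≤ |s - t| := by
  wlog hst : s ≤ t generalizing s t p q
  · rw [dist_comm, abs_sub_comm]
    exact this ht hs hq hp (le_of_not_ge hst)
  by_cases h : ∃ u ∈ Icc s t, 𝒳.proj (c u) = j
  swap
  · push Not at h
    exact 𝒳.dist_collapse_le_of_avoids hc hj hs ht (by rwa [uIcc_of_le hst]) hp hq
  have hsub : Icc s t ⊆ Icc 0 (dist x y) := Icc_subset_Icc hs.1 ht.2
  have hf : ContinuousOn (fun u => 𝒳.proj (c u)) (Icc s t) :=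
    (𝒳.continuousOn_proj_geodesic hc).mono hsub
  obtain ⟨⟨v, ⟨hv, hvj⟩, hvmin⟩, w, ⟨hw, hwj⟩, hwmax⟩ :=
    exists_isLeast_isGreatest_of_continuousOn hf h
  have h1 := 𝒳.dist_collapse_le_of_first hX hc hj hs (hsub hv) hvj (fun u hu huv huj => by
    rw [uIcc_of_le hv.1] at hu
    exact huv (le_antisymm hu.2 (hvmin ⟨⟨hu.1, hu.2.trans hv.2⟩, huj⟩))) hp
  have h2 := 𝒳.dist_collapse_le_of_first hX hc hj ht (hsub hw) hwj (fun u hu huw huj => by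
    rw [uIcc_of_ge hw.2] at hu
    exact huw (le_antisymm (hwmax ⟨⟨hw.1.trans hu.1, hu.2⟩, huj⟩) hu.1)) hq
  have hvw : v ≤ w := hvmin ⟨hw, hwj⟩
  have h3 := hc.2.2 v (hsub hv) w (hsub hw)
  rw [abs_of_nonpos (by linarith [hv.1])] at h1
  rw [abs_of_nonneg (by linarith [hw.2])] at h2
  rw [abs_of_nonpos (by linarith)] at h3
  rw [abs_of_nonpos (by linarith)]
  rw [dist_comm] at h2
  linarith [dist_triangle4 p (c v) (c w) q]

/-- Collapsing to a vertex space is `1`-Lipschitz from the metric of `X` to the path metric of the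
vertex space, for pairs of points that are closer to each other than to the ends of the star. -/
lemma dist_le_of_collapse (hX : IsGeodesicSpace X) {j : ℤ} {x y : X} {a b : Y j}
    (ha : 𝒳.Collapse j x (𝒳.incl j a)) (hb : 𝒳.Collapse j y (𝒳.incl j b))
    (h : |𝒳.proj x - j| + dist x y < 1) : dist a b ≤ dist x y := by
  obtain ⟨c, hc⟩ := hX x y
  have hc' : IsGeodesicSegment c x y := hc
  have h0 : (0 : ℝ) ∈ Icc 0 (dist x y) := ⟨le_rfl, dist_nonneg⟩
  have h1 : dist x y ∈ Icc 0 (dist x y) := ⟨dist_nonneg, le_rfl⟩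
  have hj : ∀ u ∈ Icc 0 (dist x y), |𝒳.proj (c u) - j| < 1 := by
    intro u hu
    have h2 := hc.2.2 u hu 0 h0
    rw [sub_zero, abs_of_nonneg hu.1, hc.1] at h2
    have h3 := 𝒳.abs_proj_sub_le hX (c u) x
    have h4 := abs_sub_le (𝒳.proj (c u)) (𝒳.proj x) j
    linarith [hu.2]
  have : Nonempty X := ⟨x⟩
  choose! g hg using fun u hu => 𝒳.exists_collapse (hj u hu)
  have hg0 : g 0 = 𝒳.incl j a := by
    have := hg 0 h0
    rw [hc.1] at this
    exact this.unique ha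
  have hg1 : g (dist x y) = 𝒳.incl j b := by
    have := hg _ h1
    rw [hc.2.1] at this
    exact this.unique hb
  have key := inducedPathEDist_le_of_lipschitz (S := {x | 𝒳.proj x = j}) (c := g)
    (dist_nonneg (x := x) (y := y))
    (fun s hs t ht => 𝒳.dist_collapse_le hX hc' hj hs ht (hg s hs) (hg t ht))
    (fun t ht => (hg t ht).proj_eq)
  rw [hg0, hg1, sub_zero] at key
  exact 𝒳.dist_le_of_inducedPathEDist_le dist_nonneg key

end TreeOfSpaces

/-! ### Trees of spaces are coarse stacks -/

namespace TreeOfSpaces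

variable {T : Set ℝ} {X : Type*} [MetricSpace X] {Y E : ℤ → Type*} [∀ j, MetricSpace (Y j)]
  [∀ j, MetricSpace (E j)] (𝒳 : TreeOfSpaces T X Y E)

lemma mem_of_nonempty (𝒳 : TreeOfSpaces T X Y E) {j : ℤ} (h : Nonempty (Y j)) : (j : ℝ) ∈ T := by
  obtain ⟨y⟩ := h
  rw [← 𝒳.range_proj]
  exact ⟨_, 𝒳.proj_incl j y⟩

lemma exists_incl_eq {j : ℤ} {x : X} (hx : 𝒳.proj x = j) : ∃ y, 𝒳.incl j y = x := by
  have : x ∈ range (𝒳.incl j) := by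
    rw [𝒳.range_incl]
    exact hx
  exact this

/-- Points of consecutive vertex spaces correspond to each other if they are close to the two ends
of a common interval of the strip between the vertex spaces. -/
def EndsOfInterval (r : ℝ) (j : ℤ) (y : Y j) (y' : Y (j + 1)) : Prop :=
  ∃ e, dist (𝒳.lower j e) y ≤ r ∧ dist (𝒳.upper j e) y' ≤ r

lemma isCoarseCorrespondence_endsOfInterval {K ε : ℝ} (hK : 1 ≤ K) (hε : 0 ≤ ε) {j : ℤ}
    (hl : IsQuasiIsometry K ε (𝒳.lower j)) (hu : IsQuasiIsometry K ε (𝒳.upper j)) :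
    IsCoarseCorrespondence ((K ^ 2 + 1) * (3 * ε + 2)) (𝒳.EndsOfInterval (ε + 1) j) := by
  have hK0 : 0 < K := by linarith
  have key : ∀ {A B : Type _} [MetricSpace A] [MetricSpace B] (f : E j → A) (g : E j → B),
      IsQIEmbedding K ε f → IsQIEmbedding K ε g → ∀ e e' a a' b b', dist (f e) a ≤ ε + 1 →
      dist (f e') a' ≤ ε + 1 → dist (g e) b ≤ ε + 1 → dist (g e') b' ≤ ε + 1 →
      dist b b' ≤ (K ^ 2 + 1) * (3 * ε + 2) * dist a a' + (K ^ 2 + 1) * (3 * ε + 2) := by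
    intro A B _ _ f g hf hg e e' a a' b b' h1 h2 h3 h4
    have h5 := (hf e e').1
    have h6 := (hg e e').2
    have h7 := dist_triangle4 (f e) a a' (f e')
    have h8 := dist_triangle4 b (g e) (g e') b'
    rw [dist_comm a' (f e')] at h7
    rw [dist_comm b (g e)] at h8
    have h9 : dist e e' ≤ K * (dist a a' + (3 * ε + 2)) := by
      rw [← div_le_iff₀' hK0]
      linarith
    have h10 := mul_le_mul_of_nonneg_left h9 hK0.le
    have h11 : 0 ≤ (K ^ 2 * (3 * ε + 1) + (3 * ε + 2)) * dist a a' := by positivity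
    linarith
  refine ⟨fun y => ?_, fun y' => ?_, ?_⟩
  · obtain ⟨e, he⟩ := hl.2 y
    exact ⟨𝒳.upper j e, e, by linarith, by rw [dist_self]; linarith⟩
  · obtain ⟨e, he⟩ := hu.2 y'
    exact ⟨𝒳.lower j e, e, by rw [dist_self]; linarith, by linarith⟩
  · rintro a b a' b' ⟨e, h1, h2⟩ ⟨e', h3, h4⟩
    exact ⟨key _ _ hl.1 hu.1 e e' a a' b b' h1 h3 h2 h4,
      key _ _ hu.1 hl.1 e e' b b' a a' h2 h4 h1 h3⟩

/-- `y` is the floor of the point `x`: its image under the collapse of the half-open strip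
`[j, j + 1)` that contains `x`. -/
def IsFloor (j : ℤ) (y : Y j) (x : X) : Prop :=
  ⌊𝒳.proj x⌋ = j ∧ 𝒳.Collapse j x (𝒳.incl j y)

lemma exists_isFloor (x : X) : ∃ j y, 𝒳.IsFloor j y x := by
  obtain ⟨z, hz⟩ := 𝒳.exists_collapse (j := ⌊𝒳.proj x⌋) (x := x) (by
    rw [abs_of_nonneg (by linarith [Int.floor_le (𝒳.proj x)])]
    linarith [Int.lt_floor_add_one (𝒳.proj x)])
  obtain ⟨y, rfl⟩ := 𝒳.exists_incl_eq hz.proj_eq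
  exact ⟨_, y, rfl, hz⟩

variable {𝒳}

lemma IsFloor.le_proj {j : ℤ} {y : Y j} {x : X} (h : 𝒳.IsFloor j y x) : (j : ℝ) ≤ 𝒳.proj x := by
  rw [← h.1]
  exact Int.floor_le _

lemma IsFloor.proj_lt {j : ℤ} {y : Y j} {x : X} (h : 𝒳.IsFloor j y x) : 𝒳.proj x < j + 1 := by
  rw [← h.1]
  exact Int.lt_floor_add_one _

/-- A point inside a strip collapses to both ends of the strip. -/
lemma IsFloor.exists_upper {j : ℤ} {y : Y j} {x : X} (h : 𝒳.IsFloor j y x)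
    (hx : (j : ℝ) < 𝒳.proj x) :
    ∃ e, 𝒳.lower j e = y ∧ 𝒳.Collapse (j + 1) x (𝒳.incl (j + 1) (𝒳.upper j e)) := by
  obtain ⟨e, t, ht, hxe⟩ := 𝒳.exists_strip ⟨hx, h.proj_lt⟩
  refine ⟨e, 𝒳.incl_injective j ?_, ?_⟩
  · rw [← 𝒳.strip_zero]
    have h' : 𝒳.Collapse j x (𝒳.strip j (e, 0)) := Or.inr (Or.inl ⟨e, t, ht, hxe, rfl⟩)
    exact h'.unique h.2
  · rw [← 𝒳.strip_one]
    exact Or.inr (Or.inr ⟨j, e, t, rfl, ht, hxe, rfl⟩)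

lemma IsFloor.dist_le {K ε : ℝ} (hK : 1 ≤ K) (hε : 0 ≤ ε) (hX : IsGeodesicSpace X) {j : ℤ}
    (hl : IsQIEmbedding K ε (𝒳.lower j)) (hu : IsQIEmbedding K ε (𝒳.upper j)) {x x' : X}
    {y y' : Y j} (h : 𝒳.IsFloor j y x) (h' : 𝒳.IsFloor j y' x') (hd : dist x x' < 1 / 2) :
    dist y y' ≤ (K ^ 2 + 1) * (3 * ε + 2) := by
  have hK0 : 0 < K := by linarith
  have h1 : 0 ≤ K ^ 2 * ε := by positivity
  have h2 : 0 ≤ K ^ 2 := by positivity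
  have hp := abs_le.1 (𝒳.abs_proj_sub_le hX x x')
  rcases lt_or_ge (𝒳.proj x) (j + 1 / 2) with hx | hx
  · have := 𝒳.dist_le_of_collapse hX h.2 h'.2 (by
      rw [abs_of_nonneg (by linarith [h.le_proj])]
      linarith)
    linarith
  -- In the upper half of the strip, the two points are compared at the upper end.
  · obtain ⟨e, rfl, he⟩ := h.exists_upper (by linarith)
    obtain ⟨e', rfl, he'⟩ := h'.exists_upper (by linarith)
    have h3 := 𝒳.dist_le_of_collapse hX he he' (by
      push_cast
      rw [abs_of_nonpos (by linarith [h.proj_lt])]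
      linarith)
    have h4 := (hu e e').1
    have h5 := (hl e e').2
    have h6 : dist e e' ≤ K * (1 / 2 + ε) := by
      rw [← div_le_iff₀' hK0]
      linarith
    have h7 := mul_le_mul_of_nonneg_left h6 hK0.le
    linarith

lemma IsFloor.endsOfInterval {ε : ℝ} (hε : 0 ≤ ε) (hX : IsGeodesicSpace X) {j : ℤ} {x x' : X}
    {y : Y j} {y' : Y (j + 1)} (h : 𝒳.IsFloor j y x) (h' : 𝒳.IsFloor (j + 1) y' x')
    (hd : dist x x' < 1 / 2) : 𝒳.EndsOfInterval (ε + 1) j y y' := by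
  have hp := abs_le.1 (𝒳.abs_proj_sub_le hX x x')
  have h1 := h'.le_proj
  push_cast at h1
  obtain ⟨e, rfl, he⟩ := h.exists_upper (by linarith)
  have h2 := 𝒳.dist_le_of_collapse hX he h'.2 (by
    push_cast
    rw [abs_of_nonpos (by linarith [h.proj_lt])]
    linarith)
  exact ⟨e, by rw [dist_self]; linarith, by linarith⟩

lemma EndsOfInterval.dist_le {r : ℝ} {j : ℤ} {y : Y j} {y' : Y (j + 1)}
    (h : 𝒳.EndsOfInterval r j y y') :
    dist (𝒳.incl j y) (𝒳.incl (j + 1) y') ≤ 2 * r + 1 := by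
  obtain ⟨e, h1, h2⟩ := h
  have h3 := 𝒳.dist_strip_left_le j e 0 1
  rw [𝒳.strip_zero, 𝒳.strip_one] at h3
  norm_num at h3
  have h4 := 𝒳.dist_incl_le j y (𝒳.lower j e)
  rw [dist_comm y] at h4
  have h5 := 𝒳.dist_incl_le (j + 1) (𝒳.upper j e) y'
  linarith [dist_triangle4 (𝒳.incl j y) (𝒳.incl j (𝒳.lower j e))
    (𝒳.incl (j + 1) (𝒳.upper j e)) (𝒳.incl (j + 1) y')]

variable (𝒳)

/-- The coarse stack formed by the vertex spaces of a tree of spaces. -/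
def coarseStack {K ε : ℝ} (hK : 1 ≤ K) (hε : 0 ≤ ε) (hX : IsGeodesicSpace X)
    (hqi : ∀ j : ℤ, (j : ℝ) ∈ T →
      IsQuasiIsometry K ε (𝒳.lower j) ∧ IsQuasiIsometry K ε (𝒳.upper j)) :
    CoarseStack X Y ((K ^ 2 + 1) * (3 * ε + 2)) where
  incl := 𝒳.incl
  dist_incl_le := 𝒳.dist_incl_le
  abs_le_dist j y y₀ := by
    simpa [𝒳.proj_incl] using 𝒳.abs_proj_sub_le hX (𝒳.incl j y) (𝒳.incl 0 y₀)
  adj := 𝒳.EndsOfInterval (ε + 1)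
  adj_correspondence j h :=
    𝒳.isCoarseCorrespondence_endsOfInterval hK hε (hqi j (𝒳.mem_of_nonempty h)).1
      (hqi j (𝒳.mem_of_nonempty h)).2
  dist_le_of_adj j y y' h := by
    have h1 : 1 ≤ K ^ 2 := one_le_pow₀ hK
    nlinarith [h.dist_le]
  floor := 𝒳.IsFloor
  exists_floor := 𝒳.exists_isFloor
  floor_incl j y := ⟨by rw [𝒳.proj_incl, Int.floor_intCast], 𝒳.collapse_incl j y⟩
  level_eq x j y j' y' h h' := h'.1.symm.trans h.1
  level_near x x' hd j y j' y' h h' := by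
    have hp := abs_le.1 (𝒳.abs_proj_sub_le hX x x')
    have h1 : (j : ℝ) < j' + 2 := by linarith [h.le_proj, h'.proj_lt]
    have h2 : (j' : ℝ) < j + 2 := by linarith [h'.le_proj, h.proj_lt]
    have h3 : j < j' + 2 := by exact_mod_cast h1
    have h4 : j' < j + 2 := by exact_mod_cast h2
    omega
  dist_floor_le x x' hd j y y' h h' :=
    h.dist_le hK hε hX (hqi j (𝒳.mem_of_nonempty ⟨y⟩)).1.1 (hqi j (𝒳.mem_of_nonempty ⟨y⟩)).2.1
      h' hd
  adj_floor x x' hd j y y' h h' := h.endsOfInterval hε hX h' hd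

end TreeOfSpaces

/-! ### Extension to the Gromov compactifications -/

section Extension

variable {A X : Type*} [MetricSpace A] [MetricSpace X]

lemma SameEnd.map {i : A → X} {p : A}
    (hi : ∀ M : ℝ, ∃ N : ℝ, ∀ a b : A, N ≤ gromovProduct p a b →
      M ≤ gromovProduct (i p) (i a) (i b)) {u v : ℕ → A} (h : SameEnd u v) :
    SameEnd (i ∘ u) (i ∘ v) := by
  intro q
  refine tendsto_atTop.2 fun M => ?_
  obtain ⟨N, hN⟩ := hi (M + dist (i p) q)
  filter_upwards [tendsto_atTop.1 (h p) N] with n hn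
  have h1 := hN _ _ hn
  have h2 := gromovProduct_le_add (i p) q (i (u n.1)) (i (v n.2)) (i (u n.1)) (i (v n.2))
  rw [dist_self, dist_self] at h2
  simp only [Function.comp_apply]
  linarith

/-- A continuous map that sends pairs of points with large Gromov product to such pairs extends
continuously to the Gromov compactifications. -/
theorem exists_isCannonThurstonMap {i : A → X} (hcont : Continuous i) (p : A)
    (hi : ∀ M : ℝ, ∃ N : ℝ, ∀ a b : A, N ≤ gromovProduct p a b →
      M ≤ gromovProduct (i p) (i a) (i b)) :
    ∃ F : GromovCompactification A → GromovCompactification X, IsCannonThurstonMap i F := by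
  let push : GromovSequence A → GromovSequence X := fun u => ⟨i ∘ u.1, SameEnd.map hi u.2⟩
  let bd : GromovBoundary A → GromovBoundary X :=
    Quot.map push fun u v (h : SameEnd u.1 v.1) => SameEnd.map hi h
  let F : GromovCompactification A → GromovCompactification X
    | .pt a => .pt (i a)
    | .ideal ξ => .ideal (bd ξ)
  have hF : ∀ u z, Represents u z → Represents (i ∘ u) (F z) := by
    rintro u (a | ξ) hu
    · intro n
      exact congrArg i (hu n)
    · obtain ⟨h, rfl⟩ := hu
      exact ⟨SameEnd.map hi h, rfl⟩
  refine ⟨F, continuous_def.2 fun U hU => ⟨hU.1.preimage hcont, fun ξ hξ q => ?_⟩, fun _ => rfl⟩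
  obtain ⟨r, hr⟩ := hU.2 (bd ξ) hξ (i p)
  obtain ⟨N, hN⟩ := hi (r + 1)
  refine ⟨N + dist q p, ?_⟩
  rintro z ⟨u, v, hu, hv, h⟩
  refine hr (F z) ⟨i ∘ u, i ∘ v, hF _ _ hu, hF _ _ hv, h.mono fun n hn => ?_⟩
  have h2 := gromovProduct_le_add q p (u n.1) (v n.2) (u n.1) (v n.2)
  rw [dist_self, dist_self] at h2
  have := hN (u n.1) (v n.2) (by linarith)
  simp only [Function.comp_apply]
  linarith

end Extension

theorem theorem3p5 {X : Type*} [MetricSpace X] {Y E : ℤ → Type*}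
    [∀ j, MetricSpace (Y j)] [∀ j, MetricSpace (E j)]
    (T : Set ℝ) (hT : T = Set.univ ∨ T = Set.Ici 0)
    (𝒳 : TreeOfSpaces T X Y E)
    (hX : ∃ δ : ℝ, IsHyperbolicSpace δ X)
    (hYE : ∃ δ : ℝ, ∀ j : ℤ, IsHyperbolicSpace δ (Y j) ∧ IsHyperbolicSpace δ (E j))
    (hqi : ∃ K ε : ℝ, 1 ≤ K ∧ 0 ≤ ε ∧ ∀ j : ℤ, (j : ℝ) ∈ T →
      IsQuasiIsometry K ε (𝒳.lower j) ∧ IsQuasiIsometry K ε (𝒳.upper j)) :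
    ∃ F : GromovCompactification (Y 0) → GromovCompactification X,
      IsCannonThurstonMap (𝒳.incl 0) F := by
  obtain ⟨δ₁, hX⟩ := hX
  obtain ⟨δ₂, hYE⟩ := hYE
  obtain ⟨K, ε, hK, hε, hqi⟩ := hqi
  have h0 : (0 : ℝ) ∈ range 𝒳.proj := by
    rw [𝒳.range_proj]
    rcases hT with rfl | rfl
    · exact mem_univ _
    · exact le_refl (0 : ℝ)
  obtain ⟨x, hx⟩ := h0
  obtain ⟨p, -⟩ := 𝒳.exists_incl_eq (j := 0) (x := x) (by rw [hx, Int.cast_zero])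
  have hcont : Continuous (𝒳.incl 0) :=
    (LipschitzWith.of_dist_le_mul (K := 1) fun a b => by
      simpa using 𝒳.dist_incl_le 0 a b).continuous
  exact exists_isCannonThurstonMap hcont p
    ((𝒳.coarseStack hK hε hX.1 hqi).exists_le_gromovProduct_incl (hX.mono (le_max_left δ₁ δ₂))
      (fun j => (hYE j).1.mono (le_max_right δ₁ δ₂)) p)
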